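/- Let $(M,g)$ be a smooth Riemannian $6$-manifold with an $SU(3)$-structure $(J,\Omega)$: $J$ is a smooth almost complex structure with $g(JX,JY)=g(X,Y)$, and $\Omega=\psi^++i\psi^-$ is a smooth complex $3$-form of type $(3,0)$ with $\psi^+\wedge\psi^-=\tfrac23\,\omega^3$, where $\omega(X,Y)=g(JX,Y)$ and the wedge product is normalised so that $\alpha\wedge\beta=\alpha\otimes\beta-\beta\otimes\alpha$ for $1$-forms. Assume that it is nearly Kähler: the Levi-Civita connection $\nabla$ satisfies $$\nabla_X\omega=-X\lrcorner\psi^+,\qquad \nabla_X\psi^+=X\wedge\omega\qquad\text{for all } X .$$ Let $R$ be the Riemann curvature tensor, $R(X,Y,Z,W)=g(\nabla_X\nabla_YZ-\nabla_Y\nabla_XZ-\nabla_{[X,Y]}Z,\,W)$, and for a $2$-tensor $h$ put, in an orthonormal frame, $$(\mathring R h)_{ij}=\sum_{k,l}R_{kilj}h_{kl}.$$ Let $\mathcal S^2_{+0}$ be the space of symmetric traceless $2$-tensors $h$ with $h\omega=\omega h$, where $(ab)_{ij}=\sum_k a_{ik}b_{kj}$. Let $\delta,\Delta\in\mathbb R$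 be such that every sectional curvature $\dfrac{R(X,Y,Y,X)}{|X|^2|Y|^2-g(X,Y)^2}$ of $M$ lies in $[\delta,\Delta]$. Then, at every point of $M$, $\mathring R$ maps $\mathcal S^2_{+0}$ into itself, and every eigenvalue of $\mathring R$ on $\mathcal S^2_{+0}$ lies in the interval $$\left[\tfrac12\big((\Delta+\delta)-3(\Delta-\delta)\big),\ \tfrac12\big((\Delta+\delta)+3(\Delta-\delta)\big)\right]=[\,2\delta-\Delta,\ 2\Delta-\delta\,].$$ -/

import Mathlib

open Bundle
open scoped Manifold ContDiff

namespace NearlyKahler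

noncomputable section

section LeviCivita

/-! ### The Levi-Civita connection, from the Koszul formula -/

variable {E : Type*} [NormedAddCommGroup E] [NormedSpace ℝ E] [FiniteDimensional ℝ E]
  {H : Type*} [TopologicalSpace H] (I : ModelWithCorners ℝ E H)
  {M : Type*} [TopologicalSpace M] [ChartedSpace H M]
  [RiemannianBundle (fun x : M ↦ TangentSpace I x)]

/-- Half of the right-hand side of the Koszul formula, so that `koszul I X Y Z x` is
`g(∇_X Y, Z)` at the point `x`. -/
def koszul (X Y Z : Π x : M, TangentSpace I x) (x : M) : ℝ :=
  (1 / 2 : ℝ) *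
    (mvfderiv I (fun p ↦ inner ℝ (Y p) (Z p)) x (X x)
      + mvfderiv I (fun p ↦ inner ℝ (X p) (Z p)) x (Y x)
      - mvfderiv I (fun p ↦ inner ℝ (X p) (Y p)) x (Z x)
      + inner ℝ (VectorField.mlieBracket I X Y x) (Z x)
      - inner ℝ (VectorField.mlieBracket I X Z x) (Y x)
      - inner ℝ (VectorField.mlieBracket I Y Z x) (X x))

variable [IsManifold I ∞ M]
  [IsContMDiffRiemannianBundle I ∞ E (fun x : M ↦ TangentSpace I x)]

set_option linter.unusedSectionVars false

variable {I} in
theorem mdifferentiableAt_inner {Y Z : Π x : M, TangentSpace I x} {x : M}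
    (hY : MDiffAt (T% Y) x) (hZ : MDiffAt (T% Z) x) :
    MDiffAt (fun p ↦ inner ℝ (Y p) (Z p)) x :=
  MDifferentiableAt.inner_bundle (F := E) (E := fun x : M ↦ TangentSpace I x) (b := fun p ↦ p)
    hY hZ

variable {I} in
theorem koszul_tensorial_left {Y Z : Π x : M, TangentSpace I x} {x : M}
    (hY : MDiffAt (T% Y) x) (hZ : MDiffAt (T% Z) x) :
    TensorialAt I E (fun X ↦ koszul I X Y Z x) x where
  smul {f X} hf hX := by
    simp [koszul, mvfderiv_fun_mul hf (mdifferentiableAt_inner hX hZ),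
      mvfderiv_fun_mul hf (mdifferentiableAt_inner hX hY), VectorField.mlieBracket_smul_left hf hX,
      inner_add_left, inner_smul_left, inner_smul_right]
    ring
  add {X X'} hX hX' := by
    simp [koszul, mvfderiv_fun_add (mdifferentiableAt_inner hX hZ) (mdifferentiableAt_inner hX' hZ),
      mvfderiv_fun_add (mdifferentiableAt_inner hX hY) (mdifferentiableAt_inner hX' hY),
      VectorField.mlieBracket_add_left hX hX', inner_add_left, inner_add_right]
    ring

variable {I} in
theorem koszul_tensorial_right {X Y : Π x : M, TangentSpace I x} {x : M}
    (hX : MDiffAt (T% X) x) (hY : MDiffAt (T% Y) x) :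
    TensorialAt I E (fun Z ↦ koszul I X Y Z x) x where
  smul {f Z} hf hZ := by
    simp [koszul, mvfderiv_fun_mul hf (mdifferentiableAt_inner hX hZ),
      mvfderiv_fun_mul hf (mdifferentiableAt_inner hY hZ),
      VectorField.mlieBracket_smul_right hf hZ,
      inner_add_left, inner_smul_left, inner_smul_right, real_inner_comm]
    ring
  add {Z Z'} hZ hZ' := by
    simp [koszul, mvfderiv_fun_add (mdifferentiableAt_inner hX hZ) (mdifferentiableAt_inner hX hZ'),
      mvfderiv_fun_add (mdifferentiableAt_inner hY hZ) (mdifferentiableAt_inner hY hZ'),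
      VectorField.mlieBracket_add_right hZ hZ', inner_add_left, inner_add_right]
    ring

/-- The bilinear form `(u, w) ↦ g(∇_u Y, w)` on the tangent space at `x`. -/
def koszulForm {Y : Π x : M, TangentSpace I x} {x : M} (hY : MDiffAt (T% Y) x) :
    TangentSpace I x →L[ℝ] TangentSpace I x →L[ℝ] ℝ :=
  TensorialAt.mkHom₂ (I := I) (F := E) (F' := E) (fun X Z ↦ koszul I X Y Z x) x
    (fun _ hZ ↦ koszul_tensorial_left hY hZ) (fun _ hX ↦ koszul_tensorial_right hX hY)

theorem koszulForm_apply {X Y Z : Π x : M, TangentSpace I x} {x : M}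
    (hX : MDiffAt (T% X) x) (hY : MDiffAt (T% Y) x) (hZ : MDiffAt (T% Z) x) :
    koszulForm I hY (X x) (Z x) = koszul I X Y Z x :=
  TensorialAt.mkHom₂_apply _ _ hX hZ

instance finiteDimensional_tangentSpace (x : M) : FiniteDimensional ℝ (TangentSpace I x) :=
  inferInstanceAs (FiniteDimensional ℝ E)

instance completeSpace_tangentSpace (x : M) : CompleteSpace (TangentSpace I x) :=
  FiniteDimensional.complete ℝ (TangentSpace I x)

open Classical in
/-- `u ↦ ∇_u Y` at the point `x`: the vector which represents the Koszul form. -/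
def leviCivitaFun (Y : Π x : M, TangentSpace I x) (x : M) :
    TangentSpace I x →L[ℝ] TangentSpace I x :=
  if hY : MDiffAt (T% Y) x then
    LinearMap.toContinuousLinearMap
      { toFun := fun u ↦ (InnerProductSpace.toDual ℝ (TangentSpace I x)).symm (koszulForm I hY u)
        map_add' := fun u v ↦ by simp
        map_smul' := fun c u ↦ by simp }
  else 0

variable {I} in
theorem inner_leviCivitaFun {X Y Z : Π x : M, TangentSpace I x} {x : M}
    (hX : MDiffAt (T% X) x) (hY : MDiffAt (T% Y) x) (hZ : MDiffAt (T% Z) x) :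
    inner ℝ (leviCivitaFun I Y x (X x)) (Z x) = koszul I X Y Z x := by
  rw [← koszulForm_apply I hX hY hZ, leviCivitaFun, dif_pos hY]
  exact InnerProductSpace.toDual_symm_apply

/-- The Levi-Civita connection of a Riemannian manifold. -/
def leviCivita : CovariantDerivative I E (fun x : M ↦ TangentSpace I x) where
  toFun := leviCivitaFun I
  isCovariantDerivativeOnUniv :=
    { add := by
        intro Y Y' x hY hY' _
        have hYY' : MDiffAt (T% (Y + Y')) x := mdifferentiableAt_add_section hY hY'
        ext u
        refine ext_inner_right ℝ fun w ↦ ?_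
        have hX := FiberBundle.mdifferentiableAt_extend I E u
        have hZ := FiberBundle.mdifferentiableAt_extend I E w
        rw [← FiberBundle.extend_apply_self E u, ← FiberBundle.extend_apply_self E w]
        rw [add_apply, inner_add_left]
        rw [inner_leviCivitaFun hX hYY' hZ, inner_leviCivitaFun hX hY hZ,
          inner_leviCivitaFun hX hY' hZ]
        simp [koszul, mvfderiv_fun_add (mdifferentiableAt_inner hY hZ)
            (mdifferentiableAt_inner hY' hZ),
          mvfderiv_fun_add (mdifferentiableAt_inner hX hY) (mdifferentiableAt_inner hX hY'),
          VectorField.mlieBracket_add_left hY hY', VectorField.mlieBracket_add_right hY hY',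
          inner_add_left, inner_add_right]
        ring
      leibniz := by
        intro Y f x hY hf _
        have hfY : MDiffAt (T% (f • Y)) x := hf.smul_section hY
        ext u
        refine ext_inner_right ℝ fun w ↦ ?_
        have hX := FiberBundle.mdifferentiableAt_extend I E u
        have hZ := FiberBundle.mdifferentiableAt_extend I E w
        rw [← FiberBundle.extend_apply_self E u, ← FiberBundle.extend_apply_self E w]
        rw [add_apply, inner_add_left, smul_apply,
          inner_smul_left]
        rw [inner_leviCivitaFun hX hfY hZ, inner_leviCivitaFun hX hY hZ]
        simp [koszul, mvfderiv_fun_mul hf (mdifferentiableAt_inner hY hZ),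
          mvfderiv_fun_mul hf (mdifferentiableAt_inner hY hX),
          VectorField.mlieBracket_smul_left hf hY, VectorField.mlieBracket_smul_right hf hY,
          inner_add_left, inner_smul_left, inner_smul_right, real_inner_comm]
        ring }


theorem leviCivita_metric {X Y Z : Π x : M, TangentSpace I x} {x : M}
    (hX : MDiffAt (T% X) x) (hY : MDiffAt (T% Y) x) (hZ : MDiffAt (T% Z) x) :
    mvfderiv I (fun p ↦ inner ℝ (Y p) (Z p)) x (X x)
      = inner ℝ (leviCivita I Y x (X x)) (Z x) + inner ℝ (Y x) (leviCivita I Z x (X x)) := by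
  have h1 : inner ℝ (leviCivita I Y x (X x)) (Z x) = koszul I X Y Z x :=
    inner_leviCivitaFun hX hY hZ
  have h2 : inner ℝ (leviCivita I Z x (X x)) (Y x) = koszul I X Z Y x :=
    inner_leviCivitaFun hX hZ hY
  rw [h1, real_inner_comm, h2]
  simp only [koszul, real_inner_comm (Y _) (Z _), VectorField.mlieBracket_swap_apply (V := Z)
    (W := Y), inner_neg_left]
  ring

theorem leviCivita_torsion {X Y : Π x : M, TangentSpace I x} {x : M}
    (hX : MDiffAt (T% X) x) (hY : MDiffAt (T% Y) x) :
    leviCivita I Y x (X x) - leviCivita I X x (Y x) = VectorField.mlieBracket I X Y x := by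
  refine ext_inner_right ℝ fun w ↦ ?_
  have hZ := FiberBundle.mdifferentiableAt_extend I E w
  rw [← FiberBundle.extend_apply_self E w, inner_sub_left]
  have h1 : inner ℝ (leviCivita I Y x (X x)) (FiberBundle.extend E w x)
      = koszul I X Y (FiberBundle.extend E w) x := inner_leviCivitaFun hX hY hZ
  have h2 : inner ℝ (leviCivita I X x (Y x)) (FiberBundle.extend E w x)
      = koszul I Y X (FiberBundle.extend E w) x := inner_leviCivitaFun hY hX hZ
  rw [h1, h2]
  simp only [koszul, VectorField.mlieBracket_swap_apply (V := Y) (W := X), inner_neg_left]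
  simp only [real_inner_comm (X _) (Y _)]
  ring

/-! ### Curvature -/

/-- `R(X, Y) Z = ∇_X ∇_Y Z - ∇_Y ∇_X Z - ∇_[X, Y] Z` at the point `x`. -/
def curvatureField (X Y Z : Π x : M, TangentSpace I x) (x : M) : TangentSpace I x :=
  leviCivita I (fun p ↦ leviCivita I Z p (Y p)) x (X x)
    - leviCivita I (fun p ↦ leviCivita I Z p (X p)) x (Y x)
    - leviCivita I Z x (VectorField.mlieBracket I X Y x)

/-- The Riemann curvature tensor `R(u, v, w, z) = g(R(u, v) w, z)` on the tangent space at `x`,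
computed with local smooth extensions of the vectors (their choice does not matter). -/
def riemann {x : M} (u v w z : TangentSpace I x) : ℝ :=
  inner ℝ (curvatureField I (FiberBundle.extend E u) (FiberBundle.extend E v)
    (FiberBundle.extend E w) x) z

/-- The sectional curvature of the plane spanned by `u` and `v`. -/
def sectionalCurvature {x : M} (u v : TangentSpace I x) : ℝ :=
  riemann I u v v u / (inner ℝ u u * inner ℝ v v - inner ℝ u v ^ 2)

variable (M) in
/-- All sectional curvatures of `M` lie in `[δ, Δ]`. -/
def SectionalCurvatureBetween (δ Δ : ℝ) : Prop :=
  ∀ (x : M) (u v : TangentSpace I x), LinearIndependent ℝ ![u, v] →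
    δ ≤ sectionalCurvature I u v ∧ sectionalCurvature I u v ≤ Δ

/-- The curvature operator on `2`-tensors at `x`: in the orthonormal frame `e`,
`(R̊ h)_ij = ∑ k l, R_kilj h_kl`. -/
def ringCurvature {ι : Type*} [Fintype ι] [DecidableEq ι] {x : M}
    (e : OrthonormalBasis ι ℝ (TangentSpace I x)) :
    LinearMap.BilinForm ℝ (TangentSpace I x) →ₗ[ℝ] LinearMap.BilinForm ℝ (TangentSpace I x) where
  toFun h := Matrix.toBilin e.toBasis
    (Matrix.of fun i j ↦ ∑ k, ∑ l, riemann I (e k) (e i) (e l) (e j) * h (e k) (e l))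
  map_add' h h' := by
    rw [← map_add]
    congr 1
    ext i j
    simp [mul_add, Finset.sum_add_distrib]
  map_smul' c h := by
    rw [RingHom.id_apply, ← map_smul]
    congr 1
    ext i j
    simp [Finset.mul_sum, mul_left_comm]

end LeviCivita

/-! ### Nearly Kähler `6`-manifolds -/

/-- The value of `α ∧ β` for two `3`-forms on six vectors, normalised so that
`α ∧ β = α ⊗ β - β ⊗ α` for `1`-forms. -/
def wedgeThreeThree {V : Type*} (α β : V → V → V → ℝ) (v : Fin 6 → V) : ℝ :=
  (1 / 36 : ℝ) * ∑ σ : Equiv.Perm (Fin 6), ((Equiv.Perm.sign σ : ℤ) : ℝ) *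
    (α (v (σ 0)) (v (σ 1)) (v (σ 2)) * β (v (σ 3)) (v (σ 4)) (v (σ 5)))

/-- The value of `τ ∧ τ ∧ τ` for a `2`-form `τ` on six vectors, with the same normalisation. -/
def cubeTwoForm {V : Type*} (τ : V → V → ℝ) (v : Fin 6 → V) : ℝ :=
  (1 / 8 : ℝ) * ∑ σ : Equiv.Perm (Fin 6), ((Equiv.Perm.sign σ : ℤ) : ℝ) *
    (τ (v (σ 0)) (v (σ 1)) * τ (v (σ 2)) (v (σ 3)) * τ (v (σ 4)) (v (σ 5)))

/-- The vector field `X` is differentiable at `x`. -/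
abbrev DiffFieldAt {M : Type*} [TopologicalSpace M] [ChartedSpace (EuclideanSpace ℝ (Fin 6)) M]
    [IsManifold (𝓡 6) ∞ M] (X : Π x : M, TangentSpace (𝓡 6) x) (x : M) : Prop :=
  MDifferentiableAt (𝓡 6) ((𝓡 6).prod 𝓘(ℝ, EuclideanSpace ℝ (Fin 6)))
    (fun p ↦ TotalSpace.mk' (EuclideanSpace ℝ (Fin 6)) p (X p)) x

/-- The vector field `X` is smooth at `x`. -/
abbrev SmoothFieldAt {M : Type*} [TopologicalSpace M] [ChartedSpace (EuclideanSpace ℝ (Fin 6)) M]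
    [IsManifold (𝓡 6) ∞ M] (X : Π x : M, TangentSpace (𝓡 6) x) (x : M) : Prop :=
  ContMDiffAt (𝓡 6) ((𝓡 6).prod 𝓘(ℝ, EuclideanSpace ℝ (Fin 6))) ∞
    (fun p ↦ TotalSpace.mk' (EuclideanSpace ℝ (Fin 6)) p (X p)) x

section SixManifold

variable (M : Type*) [TopologicalSpace M] [ChartedSpace (EuclideanSpace ℝ (Fin 6)) M]
  [RiemannianBundle (fun x : M ↦ TangentSpace (𝓡 6) x)] [IsManifold (𝓡 6) ∞ M]

/-- An `SU(3)`-structure `(J, Ω)` on a Riemannian `6`-manifold: a smooth almost complex structure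
`J` compatible with the metric and a smooth complex `3`-form `Ω = ψ⁺ + i ψ⁻` of type `(3, 0)`
with `ψ⁺ ∧ ψ⁻ = (2/3) ω³`, where `ω(u, v) = g(J u, v)`. -/
structure SU3Structure where
  J : Π x : M, TangentSpace (𝓡 6) x →L[ℝ] TangentSpace (𝓡 6) x
  contMDiff_J : ContMDiff (𝓡 6)
    ((𝓡 6).prod 𝓘(ℝ, EuclideanSpace ℝ (Fin 6) →L[ℝ] EuclideanSpace ℝ (Fin 6))) ∞
    (fun x ↦ TotalSpace.mk' (EuclideanSpace ℝ (Fin 6) →L[ℝ] EuclideanSpace ℝ (Fin 6)) x (J x))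
  J_J : ∀ (x : M) (u : TangentSpace (𝓡 6) x), J x (J x u) = -u
  inner_J_J : ∀ (x : M) (u v : TangentSpace (𝓡 6) x), inner ℝ (J x u) (J x v) = inner ℝ u v
  Omega : Π x : M, TangentSpace (𝓡 6) x →L[ℝ] TangentSpace (𝓡 6) x →L[ℝ]
    TangentSpace (𝓡 6) x →L[ℝ] ℂ
  contMDiff_Omega : ∀ (x : M) (X Y Z : Π x : M, TangentSpace (𝓡 6) x),
    SmoothFieldAt X x → SmoothFieldAt Y x → SmoothFieldAt Z x →
    ContMDiffAt (𝓡 6) 𝓘(ℝ, ℂ) ∞ (fun p ↦ Omega p (X p) (Y p) (Z p)) x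
  Omega_swap_left : ∀ (x : M) (u v w : TangentSpace (𝓡 6) x), Omega x v u w = -Omega x u v w
  Omega_swap_right : ∀ (x : M) (u v w : TangentSpace (𝓡 6) x), Omega x u w v = -Omega x u v w
  Omega_type : ∀ (x : M) (u v w : TangentSpace (𝓡 6) x),
    Omega x u v (J x w) = Complex.I * Omega x u v w
  normalised : ∀ (x : M) (v : Fin 6 → TangentSpace (𝓡 6) x),
    wedgeThreeThree (fun a b c ↦ (Omega x a b c).re) (fun a b c ↦ (Omega x a b c).im) v
      = (2 / 3 : ℝ) * cubeTwoForm (fun a b ↦ inner ℝ (J x a) b) v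

end SixManifold

namespace SU3Structure

variable {M : Type*} [TopologicalSpace M] [ChartedSpace (EuclideanSpace ℝ (Fin 6)) M]
  [RiemannianBundle (fun x : M ↦ TangentSpace (𝓡 6) x)] [IsManifold (𝓡 6) ∞ M]

/-- The fundamental `2`-form `ω(u, v) = g(J u, v)`. -/
def omega (S : SU3Structure M) {x : M} (u v : TangentSpace (𝓡 6) x) : ℝ :=
  inner ℝ (S.J x u) v

/-- The `3`-form `ψ⁺ = Re Ω`. -/
def psiPlus (S : SU3Structure M) {x : M} (u v w : TangentSpace (𝓡 6) x) : ℝ :=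
  (S.Omega x u v w).re

/-- The nearly Kähler equations `∇_X ω = - X ⌟ ψ⁺` and `∇_X ψ⁺ = X ∧ ω`, evaluated on vector
fields `Y`, `Z`, `W` which are differentiable at the point. -/
structure IsNearlyKahler
    [IsContMDiffRiemannianBundle (𝓡 6) ∞ (EuclideanSpace ℝ (Fin 6))
      (fun x : M ↦ TangentSpace (𝓡 6) x)] (S : SU3Structure M) : Prop where
  deriv_omega : ∀ (x : M) (u : TangentSpace (𝓡 6) x) (Y Z : Π x : M, TangentSpace (𝓡 6) x),
    DiffFieldAt Y x → DiffFieldAt Z x →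
    mvfderiv (𝓡 6) (fun p ↦ S.omega (Y p) (Z p)) x u
        - S.omega (leviCivita (𝓡 6) Y x u) (Z x) - S.omega (Y x) (leviCivita (𝓡 6) Z x u)
      = -S.psiPlus u (Y x) (Z x)
  deriv_psiPlus : ∀ (x : M) (u : TangentSpace (𝓡 6) x) (Y Z W : Π x : M, TangentSpace (𝓡 6) x),
    DiffFieldAt Y x → DiffFieldAt Z x → DiffFieldAt W x →
    mvfderiv (𝓡 6) (fun p ↦ S.psiPlus (Y p) (Z p) (W p)) x u
        - S.psiPlus (leviCivita (𝓡 6) Y x u) (Z x) (W x)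
        - S.psiPlus (Y x) (leviCivita (𝓡 6) Z x u) (W x)
        - S.psiPlus (Y x) (Z x) (leviCivita (𝓡 6) W x u)
      = inner ℝ u (Y x) * S.omega (Z x) (W x) + inner ℝ u (Z x) * S.omega (W x) (Y x)
        + inner ℝ u (W x) * S.omega (Y x) (Z x)

/-- The space `S²₊₀` at `x`: the symmetric `2`-tensors `h` which commute with `ω` and are
traceless, in terms of the components in the orthonormal frame `e`. -/
def symPlusTraceless (S : SU3Structure M) {x : M}
    (e : OrthonormalBasis (Fin 6) ℝ (TangentSpace (𝓡 6) x)) :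
    Submodule ℝ (LinearMap.BilinForm ℝ (TangentSpace (𝓡 6) x)) where
  carrier := {h | (∀ u v, h u v = h v u) ∧
    (∀ i j, ∑ k, h (e i) (e k) * S.omega (e k) (e j)
      = ∑ k, S.omega (e i) (e k) * h (e k) (e j)) ∧
    ∑ i, h (e i) (e i) = 0}
  zero_mem' := by simp
  add_mem' := by
    rintro a b ⟨ha, ha', ha''⟩ ⟨hb, hb', hb''⟩
    refine ⟨fun u v ↦ ?_, fun i j ↦ ?_, ?_⟩
    · simp [ha u v, hb u v]
    · simp [add_mul, mul_add, Finset.sum_add_distrib, ha' i j, hb' i j]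
    · simp [Finset.sum_add_distrib, ha'', hb'']
  smul_mem' := by
    rintro c a ⟨ha, ha', ha''⟩
    refine ⟨fun u v ↦ ?_, fun i j ↦ ?_, ?_⟩
    · simp [ha u v]
    · simp [mul_assoc, mul_left_comm _ c, ← Finset.mul_sum, ha' i j]
    · simp [← Finset.mul_sum, ha'']

end SU3Structure

end

end NearlyKahler

/-!
The theorem compares the curvature `R` of `M` with the curvature `R₁` of the round unit sphere,
which is itself nearly Kähler in dimension `6`, and studies the difference `K = R - R₁`.

Differentiating the nearly Kähler equations once more and antisymmetrising (the Ricci identity)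
shows that `R(X, Y)` acts on `ω` and on `ψ⁺` exactly as `R₁(X, Y)` does (`omega_curvatureField`,
`psiPlus_curvatureField`). Hence `K(X, Y)` annihilates `ω` and `ψ⁺`, so it is an element of `su(3)`.
That it annihilates `ω` means that it commutes with `J`: `K` is a curvature tensor of Kähler type
(`isKahlerType`). That it annihilates `ψ⁺`, hence `Ω`, means that its complex trace vanishes,
because `Ω` is nonzero on unitary frames by the normalisation `ψ⁺ ∧ ψ⁻ = (2/3) ω³`
(`sum_sub_unitCurvature_eq_zero`). By the Bianchi identity `K` is then Ricci-flat
(`IsKahlerType.ricci_eq_zero`).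

A tensor `h` in `S²₊₀` is diagonal in a unitary frame `f₁, J f₁, f₂, J f₂, f₃, J f₃`, with
eigenvalues `c₁, c₁, c₂, c₂, c₃, c₃` and `c₁ + c₂ + c₃ = 0`, and in this frame
`(R̊h)(u, v) = ∑ a, c_a (R(f_a, u, f_a, v) + R(J f_a, u, J f_a, v))` (`ringCurvature_apply`).
The part of the sum which comes from `R₁` is `h` itself. The part which comes from `K` is
`J`-invariant because `K` is of Kähler type, and traceless because `K` is Ricci-flat.
So `R̊` preserves `S²₊₀`.

For the bound let `R̊h = r h` and let `c₁` have the largest modulus. Evaluating on `(f₁, f₁)` gives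
`r c₁ = -c₁ H - c₂ S₂ - c₃ S₃`, where `H` is the sectional curvature of the plane of `f₁, J f₁` and
each `S_a` is the sum of those of the planes of `f₁, f_a` and of `f₁, J f_a`. Since `c₂ + c₃ = -c₁`
and `|c₂|, |c₃| ≤ |c₁|`, the numbers `-c₂ / c₁` and `-c₃ / c₁` are nonnegative with sum `1`, so that
`r = -H + (a convex combination of S₂ and S₃)` lies between `2δ - Δ` and `2Δ - δ`
(`eigenvalue_mem_Icc`).

Mathlib has no curvature tensor. The symmetries of `riemann` are derived here from the Koszul
formula: the needed inputs are that `∇_Y Z` is smooth when `Y` and `Z` are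
(`contMDiffAt_leviCivita`) and that the Lie bracket acts on functions as the commutator of
derivatives (`mvfderiv_mlieBracket`). Multilinearity of `riemann`, which is defined through
extensions of the four vectors, is not proved directly: linearity in the last slot is plain, and the
symmetries carry it to the others.
-/

namespace NearlyKahler

open Filter Topology VectorField

set_option linter.unusedSectionVars false

/-! ### Directional derivatives and the Lie bracket -/

section Commutator

variable {E : Type*} [NormedAddCommGroup E] [NormedSpace ℝ E]
  {H : Type*} [TopologicalSpace H] {I : ModelWithCorners ℝ E H}
  {M : Type*} [TopologicalSpace M] [ChartedSpace H M]

theorem mvfderiv_congr_of_eventuallyEq {f g : M → ℝ} {x : M} (h : f =ᶠ[𝓝 x] g) :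
    mvfderiv I f x = mvfderiv I g x := by
  ext v
  simp only [mvfderiv, ContinuousLinearMap.comp_apply, h.mfderiv_eq]
  rw [show f x = g x from h.self_of_nhds]
  rfl

theorem contMDiffAt_mvfderiv_apply [IsManifold I ∞ M] {f : M → ℝ} {X : Π x : M, TangentSpace I x}
    {x : M} (hf : CMDiffAt ∞ f x) (hX : CMDiffAt ∞ (T% X) x) :
    CMDiffAt ∞ (fun p ↦ mvfderiv I f p (X p)) x := by
  have : IsManifold I 1 M := IsManifold.of_le (n := ∞) (by simp)
  have h := hf.mfderiv_const (m := ∞) (by simp)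
  have h2 := ContMDiffAt.clm_apply_of_inCoordinates (b₁ := id) (b₂ := f) h hX hf
  rw [contMDiffAt_totalSpace] at h2
  have h3 := h2.2
  simp at h3
  exact h3

variable [CompleteSpace E] [I.Boundaryless] [IsManifold I ∞ M]

/-- The Lie bracket of vector fields acts on functions as the commutator of the two derivatives. The
identity is pulled back to the model space by the chart at `x`, where it expresses the symmetry of
the second derivative. -/
theorem mvfderiv_mlieBracket {f : M → ℝ} {X Y : Π x : M, TangentSpace I x}
    {x : M} (hf : CMDiffAt ∞ f x) (hX : CMDiffAt ∞ (T% X) x) (hY : CMDiffAt ∞ (T% Y) x) :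
    mvfderiv I f x (mlieBracket I X Y x)
      = mvfderiv I (fun p ↦ mvfderiv I f p (Y p)) x (X x)
        - mvfderiv I (fun p ↦ mvfderiv I f p (X p)) x (Y x) := by
  have : IsManifold I 1 M := IsManifold.of_le (n := ∞) (by simp)
  set φ := extChartAt I x with hφ
  let f' : E → ℝ := f ∘ φ.symm
  let P : (Π x : M, TangentSpace I x) → E → E := fun V ↦
    mpullbackWithin 𝓘(ℝ, E) I φ.symm V (Set.range I)
  have hP (V) (hV : CMDiffAt ∞ (T% V) x) : DifferentiableAt ℝ (P V) (φ x) := by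
    have h := contMDiffWithinAt_mpullbackWithin_extChartAt_symm (n := ∞) hV.contMDiffWithinAt
      uniqueMDiffOn_univ (Set.mem_univ x) (by simp)
    have h2 := (contMDiffWithinAt_vectorSpace_iff_contDiffWithinAt.1 h)
    have h3 := h2.contDiffAt (by
      simpa using extChartAt_target_mem_nhds x)
    exact h3.differentiableAt (by simp)
  have hf' : ContDiffAt ℝ ∞ f' (φ x) := by
    have h : ContMDiffAt 𝓘(ℝ, E) I ∞ φ.symm (φ x) :=
      (contMDiffOn_extChartAt_symm x).contMDiffAt (extChartAt_target_mem_nhds x)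
    rw [← contMDiffAt_iff_contDiffAt]
    refine ContMDiffAt.comp (φ x) ?_ h
    rw [hφ, extChartAt_to_inv x]
    exact hf
  -- derivatives along a field agree with derivatives in the chart along the pulled-back field
  have key (V : Π x : M, TangentSpace I x) (g : M → ℝ) (y : E) (hy : y ∈ φ.target)
      (hg : MDiffAt g (φ.symm y)) :
      fderiv ℝ (g ∘ φ.symm) y (P V y) = mvfderiv I g (φ.symm y) (V (φ.symm y)) := by
    have hinv := isInvertible_mfderivWithin_extChartAt_symm (I := I) hy
    have hd : MDifferentiableAt 𝓘(ℝ, E) I φ.symm y :=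
      ((contMDiffOn_extChartAt_symm (n := ∞) x).contMDiffAt
        ((isOpen_extChartAt_target x).mem_nhds hy)).mdifferentiableAt (by simp)
    rw [← mfderiv_eq_fderiv, mfderiv_comp y hg hd]
    simp only [P, mpullbackWithin_apply, I.range_eq_univ, mfderivWithin_univ] at hinv ⊢
    change mfderiv I 𝓘(ℝ, ℝ) g (φ.symm y) (mfderiv 𝓘(ℝ, E) I φ.symm y
      ((mfderiv 𝓘(ℝ, E) I φ.symm y).inverse (V (φ.symm y)))) = _
    rw [hinv.self_apply_inverse]
    rfl
  have hnear : ∀ᶠ y in 𝓝 (φ x), y ∈ φ.target ∧ MDiffAt f (φ.symm y) := by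
    have h1 : ∀ᶠ p in 𝓝 x, MDiffAt f p := by
      filter_upwards [(contMDiffAt_iff_contMDiffAt_nhds (n := 1) (by simp)).1
        (hf.of_le (by simp))] with p hp
      exact hp.mdifferentiableAt (by simp)
    have h2 : Tendsto φ.symm (𝓝 (φ x)) (𝓝 x) := by
      simpa [hφ] using (continuousAt_extChartAt_symm (I := I) x).tendsto
    exact Filter.Eventually.and (extChartAt_target_mem_nhds x) (h2.eventually h1)
  have hxt : φ x ∈ φ.target := mem_extChartAt_target x
  have hxx : φ.symm (φ x) = x := extChartAt_to_inv x
  have hD (V : Π x : M, TangentSpace I x) : (fun y ↦ fderiv ℝ f' y (P V y)) =ᶠ[𝓝 (φ x)]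
      (fun p ↦ mvfderiv I f p (V p)) ∘ φ.symm := by
    filter_upwards [hnear] with y hy using key V f y hy.1 hy.2
  have hsecond (V W : Π x : M, TangentSpace I x) (hV : CMDiffAt ∞ (T% V) x) :
      fderiv ℝ (fun y ↦ fderiv ℝ f' y (P V y)) (φ x) (P W (φ x))
        = mvfderiv I (fun p ↦ mvfderiv I f p (V p)) x (W x) := by
    have hmd : MDiffAt (fun p ↦ mvfderiv I f p (V p)) x :=
      (contMDiffAt_mvfderiv_apply hf hV).mdifferentiableAt (by simp)
    rw [(hD V).fderiv_eq, key W _ _ hxt (by rwa [hxx]), hxx]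
  have hbr : P (mlieBracket I X Y) (φ x) = lieBracket ℝ (P X) (P Y) (φ x) := by
    have hid (A : E →L[ℝ] E) (hA : A = ContinuousLinearMap.id ℝ E) (v : E) :
        A.inverse v = v := by simp [hA]
    have h1 : P (mlieBracket I X Y) (φ x) = mlieBracket I X Y (φ.symm (φ x)) :=
      hid _ (mfderivWithin_range_extChartAt_symm (I := I)) _
    have h2 : mlieBracket I X Y x = lieBracket ℝ (P X) (P Y) (φ x) := by
      rw [← mlieBracketWithin_univ, mlieBracketWithin_apply]
      refine (hid _ (mfderiv_extChartAt_self (I := I)) _).trans ?_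
      rw [Set.preimage_univ, Set.univ_inter]
      simp only [I.range_eq_univ, P]
      exact congrFun lieBracketWithin_univ _
    rw [h1, ← h2, hxx]
  have h0 := fderiv_apply_lieBracket_of_isSymmSndFDerivAt (hf'.of_le ENat.LEInfty.out)
    (hf'.isSymmSndFDerivAt (by simpa using ENat.LEInfty.out)) (hP Y hY) (hP X hX)
  rw [hsecond Y X hY, hsecond X Y hX, ← hbr,
    key (mlieBracket I X Y) f _ hxt (by rw [hxx]; exact hf.mdifferentiableAt (by simp)), hxx] at h0
  exact h0

end Commutator

/-! ### Smoothness of the Levi-Civita connection -/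

theorem contMDiffAt_det {E : Type*} [NormedAddCommGroup E] [NormedSpace ℝ E]
    {H : Type*} [TopologicalSpace H] {I : ModelWithCorners ℝ E H}
    {M : Type*} [TopologicalSpace M] [ChartedSpace H M] {n : Type*} [Fintype n]
    [DecidableEq n] {A : M → Matrix n n ℝ} {x : M}
    (hA : ∀ i j, CMDiffAt ∞ (fun p ↦ A p i j) x) : CMDiffAt ∞ (fun p ↦ (A p).det) x := by
  simp only [Matrix.det_apply']
  refine ContMDiffAt.sum fun σ _ ↦ ?_
  exact contMDiffAt_const.mul (contMDiffAt_finsetProd fun i _ ↦ hA _ _)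

section Smoothness

variable {E : Type*} [NormedAddCommGroup E] [NormedSpace ℝ E] [FiniteDimensional ℝ E]
  {H : Type*} [TopologicalSpace H] {I : ModelWithCorners ℝ E H}
  {M : Type*} [TopologicalSpace M] [ChartedSpace H M]
  [RiemannianBundle (fun x : M ↦ TangentSpace I x)] [IsManifold I ∞ M]
  [IsContMDiffRiemannianBundle I ∞ E (fun x : M ↦ TangentSpace I x)]

theorem contMDiffAt_inner {Y Z : Π x : M, TangentSpace I x} {x : M}
    (hY : CMDiffAt ∞ (T% Y) x) (hZ : CMDiffAt ∞ (T% Z) x) :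
    CMDiffAt ∞ (fun p ↦ inner ℝ (Y p) (Z p)) x :=
  ContMDiffAt.inner_bundle (F := E) (E := fun x : M ↦ TangentSpace I x) (b := fun p ↦ p) hY hZ

/-- A vector field is smooth if its inner products with smooth vector fields are: by Cramer's rule
its components in a local frame are quotients of determinants of such inner products. -/
theorem contMDiffAt_of_inner {T : Π x : M, TangentSpace I x} {x : M}
    (hT : ∀ W : Π x : M, TangentSpace I x, CMDiffAt ∞ (T% W) x →
      CMDiffAt ∞ (fun p ↦ inner ℝ (T p) (W p)) x) :
    CMDiffAt ∞ (T% T) x := by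
  have : IsManifold I (∞ + 1) M := by simpa using ‹IsManifold I ∞ M›
  set t := trivializationAt E (fun x : M ↦ TangentSpace I x) x with ht
  have hx : x ∈ t.baseSet := FiberBundle.mem_baseSet_trivializationAt' x
  set b := Module.finBasis ℝ E
  rw [contMDiffAt_iff_localFrameCoeff (e := t) b hx]
  intro i
  have hs (j) : CMDiffAt ∞ (T% (t.localFrame b j)) x := contMDiffAt_localFrame_of_mem ∞ t b j hx
  let G : M → Matrix _ _ ℝ := fun p ↦ Matrix.gram ℝ (fun j ↦ t.localFrame b j p)
  let k : M → _ → ℝ := fun p j ↦ inner ℝ (T p) (t.localFrame b j p)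
  have hG : ∀ j l, CMDiffAt ∞ (fun p ↦ G p j l) x := fun j l ↦ contMDiffAt_inner (hs j) (hs l)
  have hdet : ∀ p ∈ t.baseSet, (G p).det ≠ 0 := fun p hp ↦
    Matrix.det_gram_ne_zero_iff_linearIndependent.2
      ((t.isLocalFrameOn_localFrame_baseSet I ∞ b).linearIndependent hp)
  have hk : CMDiffAt ∞ (fun p ↦ ((G p).updateCol i (k p)).det) x := by
    refine contMDiffAt_det fun j l ↦ ?_
    by_cases h : l = i
    · subst h
      simpa using hT _ (hs j)
    · simpa [Matrix.updateCol_ne h] using hG j l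
  have hq := (contMDiffAt_det hG).inv₀ (hdet x hx) |>.mul hk
  refine hq.congr_of_eventuallyEq ?_
  filter_upwards [t.open_baseSet.mem_nhds hx] with p hp
  set c : _ → ℝ := fun j ↦ t.localFrameCoeff I b j p (T p)
  have hsum : T p = ∑ j, c j • t.localFrame b j p :=
    t.eq_sum_localFrameCoeff_smul (s := T) (b := b) hp
  have hGc : (G p).mulVec c = k p := by
    ext j
    simp only [G, k, Matrix.mulVec, dotProduct, Matrix.gram_apply]
    conv_rhs => rw [hsum]
    simp [sum_inner, inner_smul_left, mul_comm, real_inner_comm]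
  have hcr : ((G p).updateCol i (k p)).det = (G p).det * c i := by
    rw [← Matrix.cramer_apply, ← hGc, Matrix.cramer_eq_adjugate_mulVec, Matrix.mulVec_mulVec,
      Matrix.adjugate_mul, Matrix.smul_mulVec, Matrix.one_mulVec]
    rfl
  change c i = ((G p).det)⁻¹ * ((G p).updateCol i (k p)).det
  rw [hcr, inv_mul_cancel_left₀ (hdet p hp)]

theorem mdifferentiableAt_of_contMDiffAt {Y : Π x : M, TangentSpace I x} {x : M}
    (hY : CMDiffAt ∞ (T% Y) x) : MDiffAt (T% Y) x :=
  hY.mdifferentiableAt (by simp)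

theorem eventually_mdifferentiableAt {Y : Π x : M, TangentSpace I x} {x : M}
    (hY : CMDiffAt ∞ (T% Y) x) : ∀ᶠ p in 𝓝 x, MDiffAt (T% Y) p := by
  have : IsManifold I (1 + 1) M := by
    rw [one_add_one_eq_two]
    exact IsManifold.of_le (n := ∞) ENat.LEInfty.out
  filter_upwards [(contMDiffAt_iff_contMDiffAt_nhds (n := 1) (by simp)).1
    (hY.of_le (by simp))] with p hp
  exact hp.mdifferentiableAt (by simp)

theorem contMDiffAt_mlieBracket {X Y : Π x : M, TangentSpace I x} {x : M}
    (hX : CMDiffAt ∞ (T% X) x) (hY : CMDiffAt ∞ (T% Y) x) :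
    CMDiffAt ∞ (T% (mlieBracket I X Y)) x := by
  have : IsManifold I (((⊤ : ℕ∞) : ℕ∞ω) + 1) M := by simpa using ‹IsManifold I ∞ M›
  have : IsManifold I (minSmoothness ℝ 2) M := by
    rw [minSmoothness_of_isRCLikeNormedField]
    exact IsManifold.of_le (n := ∞) ENat.LEInfty.out
  exact ContMDiffAt.mlieBracket_vectorField (m := ⊤) (n := ⊤) hX hY (by simp)

/-- `∇_Y Z` is smooth, since the Koszul formula gives its inner products with smooth fields. -/
theorem contMDiffAt_leviCivita {Y Z : Π x : M, TangentSpace I x} {x : M}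
    (hY : CMDiffAt ∞ (T% Y) x) (hZ : CMDiffAt ∞ (T% Z) x) :
    CMDiffAt ∞ (T% (fun p ↦ leviCivita I Z p (Y p))) x := by
  refine contMDiffAt_of_inner fun W hW ↦ ?_
  have h : CMDiffAt ∞ (fun p ↦ koszul I Y Z W p) x := by
    refine contMDiffAt_const.mul ?_
    exact (((((contMDiffAt_mvfderiv_apply (contMDiffAt_inner hZ hW) hY).add
      (contMDiffAt_mvfderiv_apply (contMDiffAt_inner hY hW) hZ)).sub
      (contMDiffAt_mvfderiv_apply (contMDiffAt_inner hY hZ) hW)).add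
      (contMDiffAt_inner (contMDiffAt_mlieBracket hY hZ) hW)).sub
      (contMDiffAt_inner (contMDiffAt_mlieBracket hY hW) hZ)).sub
      (contMDiffAt_inner (contMDiffAt_mlieBracket hZ hW) hY)
  refine h.congr_of_eventuallyEq ?_
  filter_upwards [eventually_mdifferentiableAt hY, eventually_mdifferentiableAt hZ,
    eventually_mdifferentiableAt hW] with p h1 h2 h3
  exact inner_leviCivitaFun h1 h2 h3

end Smoothness

/-! ### Symmetries of the curvature -/

section Curvature

variable {E : Type*} [NormedAddCommGroup E] [NormedSpace ℝ E] [FiniteDimensional ℝ E]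
  {H : Type*} [TopologicalSpace H] {I : ModelWithCorners ℝ E H} [I.Boundaryless]
  {M : Type*} [TopologicalSpace M] [ChartedSpace H M]
  [RiemannianBundle (fun x : M ↦ TangentSpace I x)] [IsManifold I ∞ M]
  [IsContMDiffRiemannianBundle I ∞ E (fun x : M ↦ TangentSpace I x)]
  {X Y Z W : Π x : M, TangentSpace I x} {x : M}

/-- Two derivatives of `g(Z, W)`. The terms with one derivative on each of `Z` and `W` are symmetric
in `X` and `Y`, so that antisymmetrising leaves the curvature. -/
theorem mvfderiv_inner_leviCivita (hX : CMDiffAt ∞ (T% X) x) (hY : CMDiffAt ∞ (T% Y) x)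
    (hZ : CMDiffAt ∞ (T% Z) x) (hW : CMDiffAt ∞ (T% W) x) :
    mvfderiv I (fun p ↦ mvfderiv I (fun q ↦ inner ℝ (Z q) (W q)) p (Y p)) x (X x)
      = inner ℝ (leviCivita I (fun p ↦ leviCivita I Z p (Y p)) x (X x)) (W x)
        + inner ℝ (leviCivita I Z x (Y x)) (leviCivita I W x (X x))
        + (inner ℝ (leviCivita I Z x (X x)) (leviCivita I W x (Y x))
          + inner ℝ (Z x) (leviCivita I (fun p ↦ leviCivita I W p (Y p)) x (X x))) := by
  have hYZ := mdifferentiableAt_of_contMDiffAt (contMDiffAt_leviCivita hY hZ)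
  have hYW := mdifferentiableAt_of_contMDiffAt (contMDiffAt_leviCivita hY hW)
  have hX' := mdifferentiableAt_of_contMDiffAt hX
  have hZ' := mdifferentiableAt_of_contMDiffAt hZ
  have hW' := mdifferentiableAt_of_contMDiffAt hW
  have h : (fun p ↦ mvfderiv I (fun q ↦ inner ℝ (Z q) (W q)) p (Y p)) =ᶠ[𝓝 x]
      fun p ↦ inner ℝ (leviCivita I Z p (Y p)) (W p) + inner ℝ (Z p) (leviCivita I W p (Y p)) := by
    filter_upwards [eventually_mdifferentiableAt hY, eventually_mdifferentiableAt hZ,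
      eventually_mdifferentiableAt hW] with p h1 h2 h3
    exact leviCivita_metric I h1 h2 h3
  rw [mvfderiv_congr_of_eventuallyEq h, mvfderiv_fun_add (mdifferentiableAt_inner hYZ hW')
    (mdifferentiableAt_inner hZ' hYW), add_apply]
  rw [leviCivita_metric I hX' hYZ hW', leviCivita_metric I hX' hZ' hYW]

theorem inner_curvatureField_add (hX : CMDiffAt ∞ (T% X) x) (hY : CMDiffAt ∞ (T% Y) x)
    (hZ : CMDiffAt ∞ (T% Z) x) (hW : CMDiffAt ∞ (T% W) x) :
    inner ℝ (curvatureField I X Y Z x) (W x) + inner ℝ (Z x) (curvatureField I X Y W x) = 0 := by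
  have h := mvfderiv_mlieBracket (contMDiffAt_inner hZ hW) hX hY
  rw [mvfderiv_inner_leviCivita hX hY hZ hW, mvfderiv_inner_leviCivita hY hX hZ hW,
    leviCivita_metric I (mdifferentiableAt_of_contMDiffAt (contMDiffAt_mlieBracket hX hY))
      (mdifferentiableAt_of_contMDiffAt hZ) (mdifferentiableAt_of_contMDiffAt hW)] at h
  simp only [curvatureField, inner_sub_left, inner_sub_right]
  linarith

theorem curvatureField_swap :
    curvatureField I X Y Z x = -curvatureField I Y X Z x := by
  simp only [curvatureField, mlieBracket_swap_apply (V := X) (W := Y), map_neg]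
  abel

/-- Differentiating `∇_Y Z - ∇_Z Y = [Y, Z]`, which holds near `x`. -/
theorem leviCivita_leviCivita_sub (hY : CMDiffAt ∞ (T% Y) x)
    (hZ : CMDiffAt ∞ (T% Z) x) :
    leviCivita I (fun p ↦ leviCivita I Z p (Y p)) x (X x)
        - leviCivita I (fun p ↦ leviCivita I Y p (Z p)) x (X x)
      = leviCivita I (mlieBracket I Y Z) x (X x) := by
  have hYZ := mdifferentiableAt_of_contMDiffAt (contMDiffAt_leviCivita hY hZ)
  have hZY := mdifferentiableAt_of_contMDiffAt (contMDiffAt_leviCivita hZ hY)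
  have hB := mdifferentiableAt_of_contMDiffAt (contMDiffAt_mlieBracket hY hZ)
  have h1 : (leviCivita I) (fun p ↦ leviCivita I Z p (Y p)) x
      = (leviCivita I) ((fun p ↦ leviCivita I Y p (Z p)) + mlieBracket I Y Z) x := by
    refine (leviCivita I).isCovariantDerivativeOnUniv.congr_of_eventuallyEq hYZ
      (mdifferentiableAt_add_section hZY hB) univ_mem ?_
    filter_upwards [eventually_mdifferentiableAt hY, eventually_mdifferentiableAt hZ] with p h1 h2
    rw [Pi.add_apply, ← leviCivita_torsion I h1 h2]
    abel
  have h2 := (leviCivita I).isCovariantDerivativeOnUniv.add hZY hB (Set.mem_univ x)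
  rw [h1, sub_eq_iff_eq_add', ← add_apply]
  exact congrArg (fun A ↦ A (X x)) h2

/-- The first Bianchi identity, from the vanishing torsion and the Jacobi identity. -/
theorem curvatureField_bianchi (hX : CMDiffAt ∞ (T% X) x) (hY : CMDiffAt ∞ (T% Y) x)
    (hZ : CMDiffAt ∞ (T% Z) x) :
    curvatureField I X Y Z x + curvatureField I Y Z X x + curvatureField I Z X Y x = 0 := by
  have : IsManifold I (minSmoothness ℝ 3) M := by
    rw [minSmoothness_of_isRCLikeNormedField]
    exact IsManifold.of_le (n := ∞) ENat.LEInfty.out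
  have h1 := leviCivita_leviCivita_sub (X := X) hY hZ
  have h2 := leviCivita_leviCivita_sub (X := Y) hZ hX
  have h3 := leviCivita_leviCivita_sub (X := Z) hX hY
  have tor {U V : Π x : M, TangentSpace I x} (hU : CMDiffAt ∞ (T% U) x)
      (hV : CMDiffAt ∞ (T% V) x) := leviCivita_torsion I
    (mdifferentiableAt_of_contMDiffAt hU) (mdifferentiableAt_of_contMDiffAt hV)
  have t1 := tor hX (contMDiffAt_mlieBracket hY hZ)
  have t2 := tor hY (contMDiffAt_mlieBracket hZ hX)
  have t3 := tor hZ (contMDiffAt_mlieBracket hX hY)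
  have hle : minSmoothness ℝ 2 ≤ ∞ := by
    rw [minSmoothness_of_isRCLikeNormedField]
    exact ENat.LEInfty.out
  have hJ := leibniz_identity_mlieBracket_apply (I := I) (hX.of_le hle) (hY.of_le hle)
    (hZ.of_le hle)
  rw [mlieBracket_swap_apply (V := mlieBracket I X Y), mlieBracket_swap (V := X) (W := Z)] at hJ
  have hneg : mlieBracket I Y (-mlieBracket I Z X) x = -mlieBracket I Y (mlieBracket I Z X) x := by
    have := mlieBracket_const_smul_right (I := I) (c := (-1 : ℝ)) (V := Y)
      (mdifferentiableAt_of_contMDiffAt (contMDiffAt_mlieBracket hZ hX))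
    simpa using this
  rw [hneg, ← t1, ← t2, ← t3, ← h1, ← h2, ← h3] at hJ
  simp only [curvatureField]
  rw [← sub_eq_zero] at hJ
  rw [← hJ]
  abel

variable (u v w z : TangentSpace I x)

theorem contMDiffAt_extend : CMDiffAt ∞ (T% (FiberBundle.extend E u)) x :=
  FiberBundle.contMDiffAt_extend I E u

theorem riemann_swap_left : riemann I u v w z = -riemann I v u w z := by
  rw [riemann, curvatureField_swap, inner_neg_left, riemann]

theorem riemann_swap_right : riemann I u v w z = -riemann I u v z w := by
  have h := inner_curvatureField_add (contMDiffAt_extend u) (contMDiffAt_extend v)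
    (contMDiffAt_extend w) (contMDiffAt_extend z)
  simp only [FiberBundle.extend_apply_self] at h
  rw [real_inner_comm] at h
  simp only [riemann]
  rw [real_inner_comm z, real_inner_comm w]
  linarith

theorem riemann_bianchi : riemann I u v w z + riemann I v w u z + riemann I w u v z = 0 := by
  simp only [riemann, ← inner_add_left]
  rw [curvatureField_bianchi (contMDiffAt_extend u) (contMDiffAt_extend v)
    (contMDiffAt_extend w), inner_zero_left]

end Curvature

/-! ### Algebraic curvature tensors -/

section Algebra

variable {V : Type*} [NormedAddCommGroup V] [InnerProductSpace ℝ V]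

/-- Algebraic curvature tensors, as functions of four vectors. Linearity is required in the last
slot only: the symmetries carry it to the other three. -/
structure IsAlgCurvature (R : V → V → V → V → ℝ) : Prop where
  swap_left : ∀ u v w z, R u v w z = -R v u w z
  swap_right : ∀ u v w z, R u v w z = -R u v z w
  bianchi : ∀ u v w z, R u v w z + R v w u z + R w u v z = 0
  add_right : ∀ u v w z z', R u v w (z + z') = R u v w z + R u v w z'
  smul_right : ∀ u v w (c : ℝ) z, R u v w (c • z) = c * R u v w z

namespace IsAlgCurvature

variable {R : V → V → V → V → ℝ} (hR : IsAlgCurvature R)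
include hR

/-- The octahedron argument: four instances of the Bianchi identity. -/
theorem pair_symm (u v w z : V) : R u v w z = R w z u v := by
  have h1 := hR.bianchi u v w z
  have h2 := hR.bianchi v w z u
  have h3 := hR.bianchi w z u v
  have h4 := hR.bianchi z u v w
  linarith [hR.swap_right v w z u, hR.swap_right w z v u, hR.swap_right z v w u,
    hR.swap_left z v u w, hR.swap_right z u w v, hR.swap_right u w z v, hR.swap_left u w v z,
    hR.swap_right u v z w, hR.swap_right v z u w, hR.swap_left v z w u]

theorem add_third (u v w w' z : V) : R u v (w + w') z = R u v w z + R u v w' z := by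
  rw [hR.swap_right, hR.add_right, hR.swap_right u v w, hR.swap_right u v w']
  ring

theorem smul_third (u v : V) (c : ℝ) (w z : V) : R u v (c • w) z = c * R u v w z := by
  rw [hR.swap_right, hR.smul_right, hR.swap_right u v w]
  ring

theorem add_left (u u' v w z : V) : R (u + u') v w z = R u v w z + R u' v w z := by
  rw [hR.pair_symm, hR.add_third, hR.pair_symm u, hR.pair_symm u']

theorem smul_left (c : ℝ) (u v w z : V) : R (c • u) v w z = c * R u v w z := by
  rw [hR.pair_symm, hR.smul_third, hR.pair_symm u]

theorem add_second (u v v' w z : V) : R u (v + v') w z = R u v w z + R u v' w z := by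
  rw [hR.swap_left, hR.add_left, hR.swap_left u v, hR.swap_left u v']
  ring

theorem smul_second (u : V) (t : ℝ) (v w z : V) : R u (t • v) w z = t * R u v w z := by
  rw [hR.swap_left, hR.smul_left, hR.swap_left u v]
  ring

theorem neg_left (u v w z : V) : R (-u) v w z = -R u v w z := by
  simpa using hR.smul_left (-1) u v w z

theorem neg_right (u v w z : V) : R u v w (-z) = -R u v w z := by
  simpa using hR.smul_right u v w (-1) z

theorem self_left (u w z : V) : R u u w z = 0 := by
  linarith [hR.swap_left u u w z]

/-- The form `(u, w) ↦ R(u, v, w, z)`, which `R̊` contracts with a `2`-tensor. -/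
def contractionForm (v z : V) : LinearMap.BilinForm ℝ V :=
  LinearMap.mk₂ ℝ (fun u w ↦ R u v w z) (fun u u' w ↦ hR.add_left u u' v w z)
    (fun c u w ↦ hR.smul_left c u v w z) (fun u w w' ↦ hR.add_third u v w w' z)
    (fun c u w ↦ hR.smul_third u v c w z)

end IsAlgCurvature

/-- The curvature tensor of constant sectional curvature `1`. -/
def unitCurvature (u v w z : V) : ℝ :=
  inner ℝ v w * inner ℝ u z - inner ℝ u w * inner ℝ v z

theorem IsAlgCurvature.sub_unitCurvature {R : V → V → V → V → ℝ} (hR : IsAlgCurvature R) :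
    IsAlgCurvature (R - unitCurvature) where
  swap_left u v w z := by
    simp only [Pi.sub_apply]
    rw [hR.swap_left]
    simp only [unitCurvature]
    ring
  swap_right u v w z := by
    simp only [Pi.sub_apply]
    rw [hR.swap_right]
    simp only [unitCurvature]
    ring
  bianchi u v w z := by
    have := hR.bianchi u v w z
    simp only [Pi.sub_apply, unitCurvature, real_inner_comm u v, real_inner_comm u w,
      real_inner_comm v w]
    linarith
  add_right u v w z z' := by
    simp only [Pi.sub_apply, hR.add_right, unitCurvature, inner_add_right]
    ring
  smul_right u v w c z := by
    simp only [Pi.sub_apply, hR.smul_right, unitCurvature, inner_smul_right]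
    ring

/-! ### Unitary eigenframes -/

/-- A frame `e₀, e₁, e₂` whose vectors and their images under `J` are orthonormal. -/
structure IsUnitaryFrame (J : V →L[ℝ] V) (e : Fin 3 → V) : Prop where
  inner_eq : ∀ a b, inner ℝ (e a) (e b) = if a = b then (1 : ℝ) else 0
  inner_J : ∀ a b, inner ℝ (e a) (J (e b)) = (0 : ℝ)

/-- A symmetric operator has a unit eigenvector orthogonal to fewer than `dim V` given eigenvectors,
because it preserves their orthogonal complement. -/
theorem exists_eigenvector_orthogonal [FiniteDimensional ℝ V] {T : V →ₗ[ℝ] V}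
    (hT : T.IsSymmetric) {n : ℕ} (hn : n < Module.finrank ℝ V) (s : Fin n → V) (μ : Fin n → ℝ)
    (hs : ∀ i, T (s i) = μ i • s i) :
    ∃ (u : V) (c : ℝ), ‖u‖ = 1 ∧ T u = c • u ∧ ∀ i, inner ℝ (s i) u = (0 : ℝ) := by
  set W := (Submodule.span ℝ (Set.range s))ᗮ with hW
  have hmem (w : V) : w ∈ W ↔ ∀ i, inner ℝ (s i) w = (0 : ℝ) := by
    rw [hW, Submodule.mem_orthogonal]
    refine ⟨fun h i ↦ h _ (Submodule.subset_span ⟨i, rfl⟩), fun h v hv ↦ ?_⟩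
    induction hv using Submodule.span_induction with
    | mem v hv => obtain ⟨i, rfl⟩ := hv; exact h i
    | zero => simp
    | add x y _ _ hx hy => rw [inner_add_left, hx, hy, add_zero]
    | smul c x _ hx => rw [inner_smul_left, hx, mul_zero]
  have hinv : ∀ w ∈ W, T w ∈ W := fun w hw ↦ by
    rw [hmem] at hw ⊢
    intro i
    rw [← hT, hs, inner_smul_left, hw, mul_zero]
  have hpos : 0 < Module.finrank ℝ W := by
    have h1 := Submodule.finrank_add_finrank_orthogonal (Submodule.span ℝ (Set.range s))
    rw [← hW] at h1
    have h2 := finrank_range_le_card (R := ℝ) s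
    rw [Fintype.card_fin, Set.finrank] at h2
    omega
  have hTW := hT.restrict_invariant hinv
  let i : Fin (Module.finrank ℝ W) := ⟨0, hpos⟩
  let u := hTW.eigenvectorBasis rfl i
  refine ⟨u, hTW.eigenvalues rfl i, ?_, ?_, (hmem _).1 u.2⟩
  · exact (hTW.eigenvectorBasis rfl).orthonormal.1 i
  · exact congrArg Subtype.val (hTW.apply_eigenvectorBasis rfl i)

variable {J : V →L[ℝ] V} (hJJ : ∀ u, J (J u) = -u) (hJ : ∀ u v, inner ℝ (J u) (J v) = inner ℝ u v)
include hJJ hJ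

theorem inner_J_left (u v : V) : inner ℝ (J u) v = -inner ℝ u (J v) := by
  rw [← hJ u (J v), hJJ, inner_neg_right, neg_neg]

theorem inner_J_self (u : V) : inner ℝ u (J u) = 0 := by
  have := inner_J_left hJJ hJ u u
  rw [real_inner_comm] at this
  linarith

/-- A symmetric operator commuting with `J` is diagonal in a unitary frame: with an eigenvector `u`
also `J u` is one, for the same eigenvalue, so three eigenvectors can be chosen one after the other.
-/
theorem exists_unitary_eigenframe [FiniteDimensional ℝ V] (hV : Module.finrank ℝ V = 6)
    {T : V →ₗ[ℝ] V} (hT : T.IsSymmetric) (hTJ : ∀ u, T (J u) = J (T u)) :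
    ∃ (e : Fin 3 → V) (c : Fin 3 → ℝ), IsUnitaryFrame J e ∧ ∀ a, T (e a) = c a • e a := by
  have hJe {u : V} {c : ℝ} (h : T u = c • u) : T (J u) = c • J u := by rw [hTJ, h, map_smul]
  obtain ⟨e0, c0, n0, h0, -⟩ := exists_eigenvector_orthogonal hT (n := 0) (by omega) ![] ![]
    (fun i ↦ i.elim0)
  obtain ⟨e1, c1, n1, h1, p1⟩ := exists_eigenvector_orthogonal hT (n := 2) (by omega)
    ![e0, J e0] ![c0, c0] (fun i ↦ by fin_cases i; exacts [h0, hJe h0])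
  obtain ⟨e2, c2, n2, h2, p2⟩ := exists_eigenvector_orthogonal hT (n := 4) (by omega)
    ![e0, J e0, e1, J e1] ![c0, c0, c1, c1]
    (fun i ↦ by fin_cases i; exacts [h0, hJe h0, h1, hJe h1])
  have a01 : inner ℝ e0 e1 = (0 : ℝ) := p1 0
  have b01 : inner ℝ (J e0) e1 = (0 : ℝ) := p1 1
  have a02 : inner ℝ e0 e2 = (0 : ℝ) := p2 0
  have b02 : inner ℝ (J e0) e2 = (0 : ℝ) := p2 1
  have a12 : inner ℝ e1 e2 = (0 : ℝ) := p2 2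
  have b12 : inner ℝ (J e1) e2 = (0 : ℝ) := p2 3
  have b01' : inner ℝ e0 (J e1) = (0 : ℝ) := by linarith [inner_J_left hJJ hJ e0 e1]
  have b02' : inner ℝ e0 (J e2) = (0 : ℝ) := by linarith [inner_J_left hJJ hJ e0 e2]
  have b12' : inner ℝ e1 (J e2) = (0 : ℝ) := by linarith [inner_J_left hJJ hJ e1 e2]
  refine ⟨![e0, e1, e2], ![c0, c1, c2], ⟨fun a b ↦ ?_, fun a b ↦ ?_⟩, fun a ↦ ?_⟩
  · fin_cases a <;> fin_cases b <;>
      simp [a01, a02, a12, n0, n1, n2, real_inner_comm e0, real_inner_comm e1]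
  · fin_cases a <;> fin_cases b <;>
      simp [inner_J_self hJJ hJ, b01', b02', b12', real_inner_comm (J e0), real_inner_comm (J e1),
        b01, b02, b12]
  · fin_cases a <;> simp [h0, h1, h2]

end Algebra

/-! ### Contraction in orthonormal bases -/

section Algebra

variable {V : Type*} [NormedAddCommGroup V] [InnerProductSpace ℝ V]

/-- Contraction of two bilinear forms does not depend on the orthonormal basis; here one of the two
forms is diagonal in the second basis. -/
theorem sum_mul_eq_sum_diagonal {ι κ : Type*} [Fintype ι] [Fintype κ]
    (b : OrthonormalBasis ι ℝ V) (f : OrthonormalBasis κ ℝ V) (B h : LinearMap.BilinForm ℝ V)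
    (c : κ → ℝ) (hh : ∀ m v, h (f m) v = c m * inner ℝ (f m) v) :
    ∑ k, ∑ l, B (b k) (b l) * h (b k) (b l) = ∑ m, c m * B (f m) (f m) := by
  have hexp (u v : V) : h u v = ∑ m, c m * (inner ℝ (f m) u * inner ℝ (f m) v) := by
    conv_lhs => rw [← f.sum_repr' u]
    simp only [map_sum, map_smul, LinearMap.sum_apply, LinearMap.smul_apply, hh, smul_eq_mul]
    exact Finset.sum_congr rfl fun m _ ↦ by ring
  have hB (m : κ) : B (f m) (f m)
      = ∑ k, ∑ l, B (b k) (b l) * (inner ℝ (f m) (b k) * inner ℝ (f m) (b l)) := by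
    conv_lhs => rw [← b.sum_repr' (f m)]
    simp only [map_sum, map_smul, LinearMap.sum_apply, LinearMap.smul_apply, smul_eq_mul,
      Finset.mul_sum]
    rw [Finset.sum_comm]
    refine Finset.sum_congr rfl fun k _ ↦ Finset.sum_congr rfl fun l _ ↦ ?_
    rw [real_inner_comm (f m), real_inner_comm (f m)]
    ring
  simp only [hexp, hB, Finset.mul_sum]
  rw [Finset.sum_comm (s := Finset.univ (α := κ))]
  refine Finset.sum_congr rfl fun k _ ↦ ?_
  rw [Finset.sum_comm (s := Finset.univ (α := κ))]
  exact Finset.sum_congr rfl fun l _ ↦ Finset.sum_congr rfl fun m _ ↦ by ring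

variable {J : V →L[ℝ] V} (hJJ : ∀ u, J (J u) = -u) (hJ : ∀ u v, inner ℝ (J u) (J v) = inner ℝ u v)

theorem IsUnitaryFrame.orthonormal {e : Fin 3 → V} (he : IsUnitaryFrame J e)
    (hJ : ∀ u v, inner ℝ (J u) (J v) = inner ℝ u v) :
    Orthonormal ℝ (Sum.elim e (fun a ↦ J (e a))) := by
  rw [orthonormal_iff_ite]
  rintro (a | a) (b | b)
  · simp [he.inner_eq]
  · simp [he.inner_J]
  · simp [real_inner_comm, he.inner_J]
  · simp [hJ, he.inner_eq]

/-- The orthonormal basis `e₀, e₁, e₂, J e₀, J e₁, J e₂` of a unitary frame. -/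
noncomputable def IsUnitaryFrame.basis {e : Fin 3 → V} (he : IsUnitaryFrame J e)
    (hJ : ∀ u v, inner ℝ (J u) (J v) = inner ℝ u v) (hV : Module.finrank ℝ V = 6) :
    OrthonormalBasis (Fin 3 ⊕ Fin 3) ℝ V :=
  haveI : FiniteDimensional ℝ V := Module.finite_of_finrank_pos (by omega)
  OrthonormalBasis.mk (he.orthonormal hJ)
    ((he.orthonormal hJ).linearIndependent.span_eq_top_of_card_eq_finrank (by simp [hV])).ge

section basis
variable {e : Fin 3 → V} (he : IsUnitaryFrame J e) (hV : Module.finrank ℝ V = 6)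

@[simp] theorem IsUnitaryFrame.basis_inl (a : Fin 3) : he.basis hJ hV (Sum.inl a) = e a := by
  simp [IsUnitaryFrame.basis]

@[simp] theorem IsUnitaryFrame.basis_inr (a : Fin 3) : he.basis hJ hV (Sum.inr a) = J (e a) := by
  simp [IsUnitaryFrame.basis]

end basis

/-! ### Curvature tensors of Kähler type -/

/-- An algebraic curvature tensor all of whose curvature operators commute with `J`. -/
structure IsKahlerType (J : V →L[ℝ] V) (K : V → V → V → V → ℝ) : Prop
    extends IsAlgCurvature K where
  J_right : ∀ u v w z, K u v (J w) z = -K u v w (J z)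

variable {K : V → V → V → V → ℝ} (hK : IsKahlerType J K)
include hK hJJ

theorem IsKahlerType.J_J_right (u v w z : V) : K u v (J w) (J z) = K u v w z := by
  rw [hK.J_right, hJJ, hK.neg_right, neg_neg]

theorem IsKahlerType.J_J_left (u v w z : V) : K (J u) (J v) w z = K u v w z := by
  rw [hK.pair_symm, hK.J_J_right hJJ, hK.pair_symm]

/-- If moreover the curvature operators are trace-free as complex endomorphisms, the Ricci tensor
vanishes. -/
theorem IsKahlerType.ricci_eq_zero {e : Fin 3 → V}
    (htr : ∀ u v, ∑ a, K u v (e a) (J (e a)) = 0) (v w : V) :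
    ∑ a, (K (e a) v (e a) w + K (J (e a)) v (J (e a)) w) = 0 := by
  rw [← neg_eq_zero, ← htr (J w) v, ← Finset.sum_neg_distrib]
  refine Finset.sum_congr rfl fun a _ ↦ ?_
  have h := hK.bianchi (J w) v (e a) (J (e a))
  have h1 : K v (e a) (J w) (J (e a)) = K (e a) v (e a) w := by
    rw [hK.J_J_right hJJ, hK.swap_left, hK.swap_right, neg_neg]
  have h2 : K (e a) (J w) v (J (e a)) = K (J (e a)) v (J (e a)) w := by
    rw [hK.pair_symm, hK.swap_left, ← hK.J_J_right hJJ (J (e a)) v (e a) (J w), hJJ, hK.neg_right,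
      neg_neg]
  linarith

omit hK hJJ

/-! ### Curvature operators in `su(3)` -/

section su3

variable {e : Fin 3 → V} {Ω : V →L[ℝ] V →L[ℝ] V →L[ℝ] ℂ}

/-- Alternating complex-valued `3`-forms of type `(3, 0)` with respect to `J`. -/
structure IsThreeZeroForm (J : V →L[ℝ] V) (Ω : V →L[ℝ] V →L[ℝ] V →L[ℝ] ℂ) : Prop where
  swap_left : ∀ u v w, Ω v u w = -Ω u v w
  swap_right : ∀ u v w, Ω u w v = -Ω u v w
  J_right : ∀ u v w, Ω u v (J w) = Complex.I * Ω u v w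

namespace IsThreeZeroForm

variable (hΩ : IsThreeZeroForm J Ω)
include hΩ

theorem J_mid (u v w : V) : Ω u (J v) w = Complex.I * Ω u v w := by
  rw [hΩ.swap_right, hΩ.J_right, hΩ.swap_right u v w, mul_neg, neg_neg]

theorem J_left (u v w : V) : Ω (J u) v w = Complex.I * Ω u v w := by
  rw [hΩ.swap_left, hΩ.J_mid, hΩ.swap_left u v w, mul_neg, neg_neg]

theorem self_left (u w : V) : Ω u u w = 0 := by
  have := hΩ.swap_left u u w
  exact self_eq_neg.1 this

theorem self_right (u w : V) : Ω w u u = 0 := self_eq_neg.1 (hΩ.swap_right w u u)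

theorem self_outer (u w : V) : Ω u w u = 0 := by
  rw [hΩ.swap_right, hΩ.self_left, neg_zero]

theorem rotate (u v w : V) : Ω u v w = Ω v w u := by
  rw [hΩ.swap_left, hΩ.swap_right, neg_neg]

/-- A form of type `(3, 0)` is determined by its value on a unitary frame. -/
theorem eq_zero_of_frame (h : Ω (e 0) (e 1) (e 2) = 0) (a b c : Fin 3) :
    Ω (e a) (e b) (e c) = 0 := by
  have h1 : Ω (e 1) (e 2) (e 0) = 0 := by rw [← hΩ.rotate, h]
  have h2 : Ω (e 2) (e 0) (e 1) = 0 := by rw [← hΩ.rotate, h1]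
  have h3 : Ω (e 1) (e 0) (e 2) = 0 := by rw [hΩ.swap_left, h, neg_zero]
  have h4 : Ω (e 0) (e 2) (e 1) = 0 := by rw [hΩ.swap_left, h2, neg_zero]
  have h5 : Ω (e 2) (e 1) (e 0) = 0 := by rw [hΩ.swap_left, h1, neg_zero]
  fin_cases a <;> fin_cases b <;> fin_cases c <;>
    simp [hΩ.self_left, hΩ.self_right, hΩ.self_outer, h, h1, h2, h3, h4, h5]

theorem apply_eq_sum (he : IsUnitaryFrame J e)
    (hJ : ∀ u v, inner ℝ (J u) (J v) = inner ℝ u v) (hV : Module.finrank ℝ V = 6) (u v w : V) :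
    Ω u v w = ∑ a, ((inner ℝ (e a) w : ℝ) + (inner ℝ (J (e a)) w : ℝ) * Complex.I)
      * Ω u v (e a) := by
  conv_lhs => rw [← (he.basis hJ hV).sum_repr' w]
  simp only [Fintype.sum_sum_type, IsUnitaryFrame.basis_inl, IsUnitaryFrame.basis_inr, map_add,
    map_sum, map_smul, hΩ.J_right, Complex.real_smul, ← Finset.sum_add_distrib]
  exact Finset.sum_congr rfl fun a _ ↦ by ring

end IsThreeZeroForm

/-- A skew endomorphism which commutes with `J` and annihilates `Re Ω` has vanishing complex trace:
it multiplies `Ω` by its trace, and on a form of type `(3, 0)` the real part determines the form. -/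
theorem sum_inner_J_eq_zero (hΩ : IsThreeZeroForm J Ω) (he : IsUnitaryFrame J e)
    (hJ : ∀ u v, inner ℝ (J u) (J v) = inner ℝ u v)
    (hV : Module.finrank ℝ V = 6) (h0 : Ω (e 0) (e 1) (e 2) ≠ 0) (A : V → V)
    (hskew : ∀ u, inner ℝ (A u) u = (0 : ℝ)) (hAJ : ∀ u, A (J u) = J (A u))
    (hA : ∀ u v w, (Ω (A u) v w + Ω u (A v) w + Ω u v (A w)).re = 0) :
    ∑ a, inner ℝ (A (e a)) (J (e a)) = (0 : ℝ) := by
  have hsk (a : Fin 3) : inner ℝ (e a) (A (e a)) = (0 : ℝ) := by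
    rw [real_inner_comm, hskew]
  set c := Ω (e 0) (e 1) (e 2) with hc
  have k2 : Ω (e 0) (e 1) (A (e 2)) = inner ℝ (J (e 2)) (A (e 2)) * Complex.I * c := by
    rw [hΩ.apply_eq_sum he hJ hV]
    simp [Fin.sum_univ_three, hΩ.self_outer, hΩ.self_right, hsk, hc]
  have k0 : Ω (A (e 0)) (e 1) (e 2) = inner ℝ (J (e 0)) (A (e 0)) * Complex.I * c := by
    rw [hΩ.rotate, hΩ.apply_eq_sum he hJ hV, hc, hΩ.rotate (e 0)]
    simp [Fin.sum_univ_three, hΩ.self_outer, hΩ.self_right, hsk]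
  have k1 : Ω (e 0) (A (e 1)) (e 2) = inner ℝ (J (e 1)) (A (e 1)) * Complex.I * c := by
    rw [hΩ.rotate, hΩ.rotate, hΩ.apply_eq_sum he hJ hV, hc, ← hΩ.rotate (e 2)]
    simp [Fin.sum_univ_three, hΩ.self_outer, hΩ.self_right, hsk]
  -- the second identity, with `J e₀` in place of `e₀`, gives the imaginary part of the first
  have r1 := hA (e 0) (e 1) (e 2)
  have r2 := hA (J (e 0)) (e 1) (e 2)
  rw [hAJ, hΩ.J_left, hΩ.J_left, hΩ.J_left] at r2
  rw [k0, k1, k2] at r1 r2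
  simp only [real_inner_comm (J _)]
  rw [Fin.sum_univ_three]
  set t0 := (inner ℝ (J (e 0)) (A (e 0)) : ℝ)
  set t1 := (inner ℝ (J (e 1)) (A (e 1)) : ℝ)
  set t2 := (inner ℝ (J (e 2)) (A (e 2)) : ℝ)
  simp at r1 r2
  by_contra ht
  have hre : (t0 + t1 + t2) * c.re = 0 := by linarith
  have him : (t0 + t1 + t2) * c.im = 0 := by linarith
  exact h0 (Complex.ext ((mul_eq_zero.1 hre).resolve_left ht)
    ((mul_eq_zero.1 him).resolve_left ht))

end su3

end Algebra

section Algebra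

variable {V : Type*} [NormedAddCommGroup V] [InnerProductSpace ℝ V] {J : V →L[ℝ] V} {e : Fin 3 → V}

/-! ### The normalisation of the complex volume form -/

/-- The matrix of `ω` in the frame `e₀, J e₀, e₁, J e₁, e₂, J e₂`. -/
def standardOmega : Matrix (Fin 6) (Fin 6) ℤ :=
  !![0, 1, 0, 0, 0, 0; -1, 0, 0, 0, 0, 0; 0, 0, 0, 1, 0, 0; 0, 0, -1, 0, 0, 0;
    0, 0, 0, 0, 0, 1; 0, 0, 0, 0, -1, 0]

/-- `ω³` takes the value `48 / 8 = 6` on the frame `e₀, J e₀, e₁, J e₁, e₂, J e₂`. -/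
theorem sum_sign_mul_standardOmega :
    ∑ σ : Equiv.Perm (Fin 6), (Equiv.Perm.sign σ : ℤ) * (standardOmega (σ 0) (σ 1)
      * standardOmega (σ 2) (σ 3) * standardOmega (σ 4) (σ 5)) = 48 := by
  decide +kernel

/-- If `Ω` vanished on a unitary frame, it would vanish on all vectors of the associated orthonormal
basis, whereas `ω³` does not. -/
theorem IsThreeZeroForm.apply_frame_ne_zero {Ω : V →L[ℝ] V →L[ℝ] V →L[ℝ] ℂ}
    (hΩ : IsThreeZeroForm J Ω) (hJJ : ∀ u, J (J u) = -u)
    (hJ : ∀ u v, inner ℝ (J u) (J v) = inner ℝ u v) (he : IsUnitaryFrame J e)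
    (hnorm : ∀ v : Fin 6 → V, wedgeThreeThree (fun a b c ↦ (Ω a b c).re)
      (fun a b c ↦ (Ω a b c).im) v = (2 / 3 : ℝ) * cubeTwoForm (fun a b ↦ inner ℝ (J a) b) v) :
    Ω (e 0) (e 1) (e 2) ≠ 0 := by
  intro h0
  let v : Fin 6 → V := ![e 0, J (e 0), e 1, J (e 1), e 2, J (e 2)]
  have hv (i : Fin 6) : ∃ a, v i = e a ∨ v i = J (e a) := by
    fin_cases i
    exacts [⟨0, .inl rfl⟩, ⟨0, .inr rfl⟩, ⟨1, .inl rfl⟩, ⟨1, .inr rfl⟩, ⟨2, .inl rfl⟩,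
      ⟨2, .inr rfl⟩]
  have hzero (i j k : Fin 6) : Ω (v i) (v j) (v k) = 0 := by
    obtain ⟨a, ha⟩ := hv i
    obtain ⟨b, hb⟩ := hv j
    obtain ⟨c, hc⟩ := hv k
    rcases ha with ha | ha <;> rcases hb with hb | hb <;> rcases hc with hc | hc <;>
      simp [ha, hb, hc, hΩ.J_left, hΩ.J_mid, hΩ.J_right, hΩ.eq_zero_of_frame h0]
  have homega (i j : Fin 6) : inner ℝ (J (v i)) (v j) = (standardOmega i j : ℝ) := by
    fin_cases i <;> fin_cases j <;>
      simp [v, standardOmega, hJJ, hJ, he.inner_eq, he.inner_J, real_inner_comm (e _) (J _),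
        -inner_self_eq_norm_sq_to_K]
  have h := hnorm v
  simp only [wedgeThreeThree, cubeTwoForm, hzero, homega] at h
  have h48 := congrArg (Int.cast (R := ℝ)) sum_sign_mul_standardOmega
  push_cast at h48
  rw [h48] at h
  norm_num at h

/-! ### The action of the curvature on `2`-tensors -/

/-- `exists_unitary_eigenframe` for a symmetric `J`-invariant bilinear form. -/
theorem exists_unitary_eigenframe_bilinForm (hV : Module.finrank ℝ V = 6)
    (hJJ : ∀ u, J (J u) = -u) (hJ : ∀ u v, inner ℝ (J u) (J v) = inner ℝ u v)
    {h : LinearMap.BilinForm ℝ V} (hsymm : ∀ u v, h u v = h v u)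
    (hcomm : ∀ u v, h (J u) v = -h u (J v)) :
    ∃ (e : Fin 3 → V) (c : Fin 3 → ℝ), IsUnitaryFrame J e ∧
      (∀ a v, h (e a) v = c a * inner ℝ (e a) v) ∧
      ∀ a v, h (J (e a)) v = c a * inner ℝ (J (e a)) v := by
  have : FiniteDimensional ℝ V := Module.finite_of_finrank_pos (by omega)
  have : CompleteSpace V := FiniteDimensional.complete ℝ V
  let T : V →ₗ[ℝ] V :=
    { toFun := fun u ↦ (InnerProductSpace.toDual ℝ V).symm (LinearMap.toContinuousLinearMap (h u))
      map_add' := fun u v ↦ by simp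
      map_smul' := fun c u ↦ by simp }
  have hT (u v : V) : inner ℝ (T u) v = h u v := InnerProductSpace.toDual_symm_apply
  have hTs : T.IsSymmetric := fun u v ↦ by rw [hT, real_inner_comm, hT, hsymm]
  have hTJ (u : V) : T (J u) = J (T u) := ext_inner_right ℝ fun v ↦ by
    rw [hT, hcomm, inner_J_left hJJ hJ, hT]
  obtain ⟨e, c, he, hc⟩ := exists_unitary_eigenframe hJJ hJ hV hTs hTJ
  have h1 (a v) : h (e a) v = c a * inner ℝ (e a) v := by
    rw [← hT, hc, real_inner_smul_left]
  refine ⟨e, c, he, h1, fun a v ↦ ?_⟩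
  rw [hcomm, h1, inner_J_left hJJ hJ, mul_neg]

/-- In the components of an orthonormal basis, `h ω = ω h` says that `h` is `J`-invariant. -/
theorem comm_omega_iff {ι : Type*} [Fintype ι] (b : OrthonormalBasis ι ℝ V)
    (hJJ : ∀ u, J (J u) = -u) (hJ : ∀ u v, inner ℝ (J u) (J v) = inner ℝ u v)
    (h : LinearMap.BilinForm ℝ V) :
    (∀ i j, ∑ k, h (b i) (b k) * inner ℝ (J (b k)) (b j)
      = ∑ k, inner ℝ (J (b i)) (b k) * h (b k) (b j)) ↔ ∀ u v, h (J u) v = -h u (J v) := by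
  have h1 (i j) : ∑ k, h (b i) (b k) * inner ℝ (J (b k)) (b j) = -h (b i) (J (b j)) := by
    conv_rhs => rw [← b.sum_repr' (J (b j))]
    simp only [map_sum, map_smul, smul_eq_mul, ← Finset.sum_neg_distrib]
    exact Finset.sum_congr rfl fun k _ ↦ by rw [inner_J_left hJJ hJ]; ring
  have h2 (i j) : ∑ k, inner ℝ (J (b i)) (b k) * h (b k) (b j) = h (J (b i)) (b j) := by
    conv_rhs => rw [← b.sum_repr' (J (b i))]
    simp only [map_sum, map_smul, smul_eq_mul, LinearMap.sum_apply, LinearMap.smul_apply]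
    exact Finset.sum_congr rfl fun k _ ↦ by rw [real_inner_comm]
  simp only [h1, h2]
  refine ⟨fun H u v ↦ ?_, fun H i j ↦ (H _ _).symm⟩
  have hext : h.comp J.toLinearMap LinearMap.id = -h.comp LinearMap.id J.toLinearMap := by
    refine LinearMap.BilinForm.ext_basis b.toBasis fun i j ↦ ?_
    simpa using (H i j).symm
  simpa using congrArg (fun B ↦ B u v) hext

/-- The tensor `R̊h` in terms of a unitary frame of eigenvectors of `h` with eigenvalues `c`. -/
def ringForm (J : V →L[ℝ] V) (R : V → V → V → V → ℝ) (e : Fin 3 → V) (c : Fin 3 → ℝ) (u v : V) :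
    ℝ :=
  ∑ a, c a * (R (e a) u (e a) v + R (J (e a)) u (J (e a)) v)

variable {R : V → V → V → V → ℝ} {c : Fin 3 → ℝ}

theorem ringForm_symm (hR : IsAlgCurvature R) (u v : V) :
    ringForm J R e c u v = ringForm J R e c v u :=
  Finset.sum_congr rfl fun a _ ↦ by rw [hR.pair_symm (e a), hR.pair_symm (J (e a))]

/-- `ringForm` as a bilinear form. -/
def IsAlgCurvature.ringBilin (hR : IsAlgCurvature R) (J : V →L[ℝ] V) (e : Fin 3 → V)
    (c : Fin 3 → ℝ) : LinearMap.BilinForm ℝ V :=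
  LinearMap.mk₂ ℝ (ringForm J R e c)
    (fun u u' v ↦ by
      simp only [ringForm, hR.add_second, ← Finset.sum_add_distrib]
      exact Finset.sum_congr rfl fun a _ ↦ by ring)
    (fun t u v ↦ by
      simp only [ringForm, hR.smul_second, smul_eq_mul, Finset.mul_sum]
      exact Finset.sum_congr rfl fun a _ ↦ by ring)
    (fun u v v' ↦ by
      simp only [ringForm, hR.add_right, ← Finset.sum_add_distrib]
      exact Finset.sum_congr rfl fun a _ ↦ by ring)
    (fun t u v ↦ by
      simp only [ringForm, hR.smul_right, smul_eq_mul, Finset.mul_sum]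
      exact Finset.sum_congr rfl fun a _ ↦ by ring)

/-- The curvature of the unit sphere acts as the identity on traceless tensors. -/
theorem ringForm_eq_add (hJ : ∀ u v, inner ℝ (J u) (J v) = inner ℝ u v)
    (he : IsUnitaryFrame J e) (hc : ∑ a, c a = 0) (u v : V) :
    ringForm J R e c u v
      = ringForm J (R - unitCurvature) e c u v
        + ∑ a, c a * (inner ℝ (e a) u * inner ℝ (e a) v
          + inner ℝ (J (e a)) u * inner ℝ (J (e a)) v) := by
  rw [← sub_eq_zero]
  simp only [ringForm, ← Finset.sum_add_distrib, ← Finset.sum_sub_distrib]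
  have h0 : ∑ a, c a * (-2 * inner ℝ u v) = 0 := by rw [← Finset.sum_mul, hc, zero_mul]
  rw [← h0]
  refine Finset.sum_congr rfl fun a _ ↦ ?_
  simp only [Pi.sub_apply, unitCurvature, hJ, he.inner_eq, if_true, real_inner_comm u]
  ring

theorem IsKahlerType.ringForm_comm_J {K : V → V → V → V → ℝ} (hK : IsKahlerType J K)
    (hJJ : ∀ u, J (J u) = -u) (u v : V) :
    ringForm J K e c (J u) v = -ringForm J K e c u (J v) := by
  simp only [ringForm, ← Finset.sum_neg_distrib]
  refine Finset.sum_congr rfl fun a _ ↦ ?_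
  have h1 : K (J (e a)) (J u) (J (e a)) v = -K (e a) u (e a) (J v) := by
    rw [hK.J_J_left hJJ, hK.J_right]
  have h2 : K (e a) (J u) (e a) v = -K (J (e a)) u (J (e a)) (J v) := by
    rw [hK.J_J_right hJJ, ← hK.J_J_left hJJ (J (e a)) u, hJJ, hK.neg_left, neg_neg]
  rw [h1, h2]
  ring

theorem ringForm_comm_J (hJJ : ∀ u, J (J u) = -u)
    (hJ : ∀ u v, inner ℝ (J u) (J v) = inner ℝ u v)
    (hK : IsKahlerType J (R - unitCurvature))
    (he : IsUnitaryFrame J e) (hc : ∑ a, c a = 0) (u v : V) :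
    ringForm J R e c (J u) v = -ringForm J R e c u (J v) := by
  rw [ringForm_eq_add hJ he hc (J u), ringForm_eq_add hJ he hc u, neg_add, hK.ringForm_comm_J hJJ,
    ← Finset.sum_neg_distrib]
  congr 1
  refine Finset.sum_congr rfl fun a _ ↦ ?_
  rw [hJ, hJ, inner_J_left hJJ hJ, ← neg_neg (inner ℝ (e a) (J u)), ← inner_J_left hJJ hJ]
  ring

/-- The trace of `R̊h` vanishes because `R` is Einstein. -/
theorem ringForm_trace (hJJ : ∀ u, J (J u) = -u)
    (hJ : ∀ u v, inner ℝ (J u) (J v) = inner ℝ u v)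
    (hK : IsKahlerType J (R - unitCurvature)) (he : IsUnitaryFrame J e)
    (htr : ∀ u v, ∑ a, (R - unitCurvature : V → V → V → V → ℝ) u v (e a) (J (e a)) = 0)
    (hc : ∑ a, c a = 0) :
    ∑ b, (ringForm J R e c (e b) (e b) + ringForm J R e c (J (e b)) (J (e b))) = 0 := by
  set K := R - unitCurvature with hKdef
  have hric := hK.ricci_eq_zero hJJ htr
  have hsum (x : V) : ∑ b, (K x (e b) x (e b) + K x (J (e b)) x (J (e b))) = 0 := by
    rw [← hric x x]
    refine Finset.sum_congr rfl fun b _ ↦ ?_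
    linarith [hK.swap_left x (e b) x (e b), hK.swap_right (e b) x x (e b),
      hK.swap_left x (J (e b)) x (J (e b)), hK.swap_right (J (e b)) x x (J (e b))]
  have h1 (b : Fin 3) : ringForm J R e c (e b) (e b) + ringForm J R e c (J (e b)) (J (e b))
      = ∑ a, c a * ((K (e a) (e b) (e a) (e b) + K (e a) (J (e b)) (e a) (J (e b)))
        + (K (J (e a)) (e b) (J (e a)) (e b) + K (J (e a)) (J (e b)) (J (e a)) (J (e b))))
        + 2 * c b := by
    rw [ringForm_eq_add (R := R) hJ he hc (e b), ringForm_eq_add (R := R) hJ he hc (J (e b)),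
      ← hKdef]
    simp only [ringForm, hJ, he.inner_eq, he.inner_J, real_inner_comm (e _) (J (e _))]
    simp [Finset.sum_add_distrib, mul_add]
    ring
  simp only [h1, Finset.sum_add_distrib]
  rw [Finset.sum_comm, ← Finset.mul_sum, hc]
  simp only [← Finset.mul_sum, Finset.sum_add_distrib] at hsum ⊢
  simp [hsum]

/-! ### The eigenvalue bound -/

/-- The eigenvalue is `-H` plus a convex combination of `S` and `T`, with weights `-y / x` and
`-z / x`. -/
theorem eigenvalue_mem_Icc {x y z H S T r δ Δ : ℝ} (hx : x ≠ 0) (hsum : x + y + z = 0)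
    (hy : |y| ≤ |x|) (hz : |z| ≤ |x|) (hr : r * x = -(x * H + y * S + z * T))
    (hH : H ∈ Set.Icc δ Δ) (hS : S ∈ Set.Icc (2 * δ) (2 * Δ)) (hT : T ∈ Set.Icc (2 * δ) (2 * Δ)) :
    r ∈ Set.Icc (2 * δ - Δ) (2 * Δ - δ) := by
  wlog hpos : 0 < x generalizing x y z
  · refine this (x := -x) (y := -y) (z := -z) (neg_ne_zero.2 hx) (by linarith) (by simpa)
      (by simpa) (by linarith) ?_
    have : x < 0 := lt_of_le_of_ne (not_lt.1 hpos) hx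
    linarith
  rw [abs_of_pos hpos] at hy hz
  have hy0 : y ≤ 0 := by linarith [(abs_le.1 hz).1]
  have hz0 : z ≤ 0 := by linarith [(abs_le.1 hy).1]
  obtain ⟨hH1, hH2⟩ := hH
  obtain ⟨hS1, hS2⟩ := hS
  obtain ⟨hT1, hT2⟩ := hT
  have a1 := mul_le_mul_of_nonneg_left hH1 hpos.le
  have a2 := mul_le_mul_of_nonneg_left hH2 hpos.le
  have b1 := mul_le_mul_of_nonneg_left hS1 (neg_nonneg.2 hy0)
  have b2 := mul_le_mul_of_nonneg_left hS2 (neg_nonneg.2 hy0)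
  have c1 := mul_le_mul_of_nonneg_left hT1 (neg_nonneg.2 hz0)
  have c2 := mul_le_mul_of_nonneg_left hT2 (neg_nonneg.2 hz0)
  have hz' : z = -x - y := by linarith
  subst hz'
  constructor
  · refine le_of_mul_le_mul_right ?_ hpos
    rw [hr]
    linarith
  · refine le_of_mul_le_mul_right ?_ hpos
    rw [hr]
    linarith

/-- An eigenvalue of `R̊` is bounded by evaluating `R̊h = r h` on an eigenvector of `h` whose
eigenvalue has the largest modulus. -/
theorem ringForm_eigenvalue_mem_Icc (hR : IsAlgCurvature R)
    (hJ : ∀ u v, inner ℝ (J u) (J v) = inner ℝ u v) (he : IsUnitaryFrame J e)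
    (hc : ∑ a, c a = 0) (hc0 : c ≠ 0) {δ Δ r : ℝ}
    (hsec : ∀ u v, inner ℝ u u = (1 : ℝ) → inner ℝ v v = (1 : ℝ) → inner ℝ u v = (0 : ℝ) →
      R u v v u ∈ Set.Icc δ Δ)
    (hr : ∀ a, ringForm J R e c (e a) (e a) = r * c a) :
    r ∈ Set.Icc (2 * δ - Δ) (2 * Δ - δ) := by
  obtain ⟨a, ha⟩ := Finite.exists_max (fun a ↦ |c a|)
  have hca : c a ≠ 0 := fun h ↦ hc0 (funext fun b ↦ by
    have := ha b
    rw [h, abs_zero] at this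
    exact abs_nonpos_iff.1 this)
  let s : Fin 3 → ℝ := fun b ↦ R (e b) (e a) (e a) (e b) + R (J (e b)) (e a) (e a) (J (e b))
  have hs : r * c a = -∑ b, c b * s b := by
    rw [← hr a, ringForm, ← Finset.sum_neg_distrib]
    refine Finset.sum_congr rfl fun b _ ↦ ?_
    rw [hR.swap_right (e b), hR.swap_right (J (e b))]
    simp only [s]
    ring
  have hJs (b) : R (J (e b)) (e a) (e a) (J (e b)) ∈ Set.Icc δ Δ :=
    hsec _ _ (by rw [hJ, he.inner_eq, if_pos rfl]) (by rw [he.inner_eq, if_pos rfl])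
      (by rw [real_inner_comm, he.inner_J])
  -- the plane of `e a` and `J (e a)` contributes one sectional curvature, the others two each
  have hsa : s a ∈ Set.Icc δ Δ := by
    simpa [s, hR.self_left] using hJs a
  have hsb (b) (hb : b ≠ a) : s b ∈ Set.Icc (2 * δ) (2 * Δ) := by
    have h1 := hsec (e b) (e a) (by rw [he.inner_eq, if_pos rfl])
      (by rw [he.inner_eq, if_pos rfl]) (by rw [he.inner_eq, if_neg hb])
    have h2 := hJs b
    exact ⟨by linarith [h1.1, h2.1], by linarith [h1.2, h2.2]⟩
  rw [Fin.sum_univ_three] at hc hs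
  match a, ha, hca, hs, hsa, hsb with
  | 0, ha, hca, hs, hsa, hsb =>
    exact eigenvalue_mem_Icc hca hc (ha 1) (ha 2) hs hsa (hsb 1 (by decide)) (hsb 2 (by decide))
  | 1, ha, hca, hs, hsa, hsb =>
    exact eigenvalue_mem_Icc hca (by linarith) (ha 0) (ha 2) (by linarith) hsa
      (hsb 0 (by decide)) (hsb 2 (by decide))
  | 2, ha, hca, hs, hsa, hsb =>
    exact eigenvalue_mem_Icc hca (by linarith) (ha 0) (ha 1) (by linarith) hsa
      (hsb 0 (by decide)) (hsb 1 (by decide))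

end Algebra

/-! ### The Ricci identities for the fundamental form and the complex volume form -/

section Trilinear

variable {V : Type*} [NormedAddCommGroup V] [NormedSpace ℝ V] (Ω : V →L[ℝ] V →L[ℝ] V →L[ℝ] ℂ)

theorem trilinear_sub_left (u u' v w : V) : Ω (u - u') v w = Ω u v w - Ω u' v w := by
  have h : Ω (u - u' + u') v w = Ω (u - u') v w + Ω u' v w :=
    congrArg (fun A : V →L[ℝ] V →L[ℝ] ℂ ↦ A v w) (Ω.map_add (u - u') u')
  rw [sub_add_cancel] at h
  exact eq_sub_of_add_eq h.symm

theorem trilinear_smul_left (c : ℝ) (u v w : V) : Ω (c • u) v w = c • Ω u v w :=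
  congrArg (fun A : V →L[ℝ] V →L[ℝ] ℂ ↦ A v w) (Ω.map_smul c u)

end Trilinear

section NearlyKahlerManifold

variable {M : Type*} [TopologicalSpace M] [ChartedSpace (EuclideanSpace ℝ (Fin 6)) M]
  [RiemannianBundle (fun x : M ↦ TangentSpace (𝓡 6) x)] [IsManifold (𝓡 6) ∞ M]
  {S : SU3Structure M} {x : M}

namespace SU3Structure

theorem isThreeZeroForm (S : SU3Structure M) (x : M) : IsThreeZeroForm (S.J x) (S.Omega x) where
  swap_left := S.Omega_swap_left x
  swap_right := S.Omega_swap_right x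
  J_right := S.Omega_type x

theorem omega_sub_left (u u' v : TangentSpace (𝓡 6) x) :
    S.omega (u - u') v = S.omega u v - S.omega u' v := by
  simp only [omega, map_sub, inner_sub_left]

theorem omega_sub_right (u v v' : TangentSpace (𝓡 6) x) :
    S.omega u (v - v') = S.omega u v - S.omega u v' := by
  simp only [omega, inner_sub_right]

theorem psiPlus_rotate (u v w : TangentSpace (𝓡 6) x) : S.psiPlus u v w = S.psiPlus v w u := by
  rw [psiPlus, (S.isThreeZeroForm x).rotate, psiPlus]

theorem psiPlus_sub_left (u u' v w : TangentSpace (𝓡 6) x) :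
    S.psiPlus (u - u') v w = S.psiPlus u v w - S.psiPlus u' v w := by
  rw [psiPlus, trilinear_sub_left, Complex.sub_re, psiPlus, psiPlus]

theorem psiPlus_smul_left (c : ℝ) (u v w : TangentSpace (𝓡 6) x) :
    S.psiPlus (c • u) v w = c * S.psiPlus u v w := by
  rw [psiPlus, trilinear_smul_left, Complex.smul_re, smul_eq_mul, psiPlus]

end SU3Structure

variable [IsContMDiffRiemannianBundle (𝓡 6) ∞ (EuclideanSpace ℝ (Fin 6))
      (fun x : M ↦ TangentSpace (𝓡 6) x)]
  {X Y Z W U : Π x : M, TangentSpace (𝓡 6) x}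

theorem contMDiffAt_J (hY : SmoothFieldAt Y x) : SmoothFieldAt (fun p ↦ S.J p (Y p)) x :=
  ContMDiffAt.clm_bundle_apply (F₁ := EuclideanSpace ℝ (Fin 6)) (F₂ := EuclideanSpace ℝ (Fin 6))
    (b := fun p ↦ p) (S.contMDiff_J x) hY

theorem contMDiffAt_omega (hY : SmoothFieldAt Y x) (hZ : SmoothFieldAt Z x) :
    ContMDiffAt (𝓡 6) 𝓘(ℝ, ℝ) ∞ (fun p ↦ S.omega (Y p) (Z p)) x :=
  contMDiffAt_inner (contMDiffAt_J hY) hZ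

theorem contMDiffAt_psiPlus (hY : SmoothFieldAt Y x) (hZ : SmoothFieldAt Z x)
    (hW : SmoothFieldAt W x) :
    ContMDiffAt (𝓡 6) 𝓘(ℝ, ℝ) ∞ (fun p ↦ S.psiPlus (Y p) (Z p) (W p)) x :=
  (Complex.reCLM.contMDiff (n := ∞)).contMDiffAt.comp x (S.contMDiff_Omega x Y Z W hY hZ hW)

theorem mvfderiv_inner_apply (hY : DiffFieldAt Y x) (hZ : DiffFieldAt Z x)
    (u : TangentSpace (𝓡 6) x) :
    mvfderiv (𝓡 6) (fun p ↦ inner ℝ (Y p) (Z p)) x u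
      = inner ℝ (leviCivita (𝓡 6) Y x u) (Z x) + inner ℝ (Y x) (leviCivita (𝓡 6) Z x u) := by
  have h := leviCivita_metric (𝓡 6) (FiberBundle.mdifferentiableAt_extend (𝓡 6) _ u) hY hZ
  rwa [FiberBundle.extend_apply_self] at h

namespace SU3Structure.IsNearlyKahler

variable (hS : S.IsNearlyKahler)
include hS

theorem mvfderiv_omega (hY : DiffFieldAt Y x) (hZ : DiffFieldAt Z x) (u : TangentSpace (𝓡 6) x) :
    mvfderiv (𝓡 6) (fun p ↦ S.omega (Y p) (Z p)) x u
      = S.omega (leviCivita (𝓡 6) Y x u) (Z x) + S.omega (Y x) (leviCivita (𝓡 6) Z x u)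
        - S.psiPlus u (Y x) (Z x) := by
  linarith [hS.deriv_omega x u Y Z hY hZ]

theorem mvfderiv_psiPlus (hY : DiffFieldAt Y x) (hZ : DiffFieldAt Z x) (hW : DiffFieldAt W x)
    (u : TangentSpace (𝓡 6) x) :
    mvfderiv (𝓡 6) (fun p ↦ S.psiPlus (Y p) (Z p) (W p)) x u
      = S.psiPlus (leviCivita (𝓡 6) Y x u) (Z x) (W x)
        + S.psiPlus (Y x) (leviCivita (𝓡 6) Z x u) (W x)
        + S.psiPlus (Y x) (Z x) (leviCivita (𝓡 6) W x u)
        + (inner ℝ u (Y x) * S.omega (Z x) (W x) + inner ℝ u (Z x) * S.omega (W x) (Y x)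
          + inner ℝ u (W x) * S.omega (Y x) (Z x)) := by
  linarith [hS.deriv_psiPlus x u Y Z W hY hZ hW]

theorem mvfderiv_mvfderiv_omega (hY : SmoothFieldAt Y x)
    (hZ : SmoothFieldAt Z x) (hW : SmoothFieldAt W x) :
    mvfderiv (𝓡 6) (fun p ↦ mvfderiv (𝓡 6) (fun q ↦ S.omega (Z q) (W q)) p (Y p)) x (X x)
      = S.omega (leviCivita (𝓡 6) (fun p ↦ leviCivita (𝓡 6) Z p (Y p)) x (X x)) (W x)
        + S.omega (leviCivita (𝓡 6) Z x (Y x)) (leviCivita (𝓡 6) W x (X x))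
        - S.psiPlus (X x) (leviCivita (𝓡 6) Z x (Y x)) (W x)
        + (S.omega (leviCivita (𝓡 6) Z x (X x)) (leviCivita (𝓡 6) W x (Y x))
          + S.omega (Z x) (leviCivita (𝓡 6) (fun p ↦ leviCivita (𝓡 6) W p (Y p)) x (X x))
          - S.psiPlus (X x) (Z x) (leviCivita (𝓡 6) W x (Y x)))
        - (S.psiPlus (leviCivita (𝓡 6) Y x (X x)) (Z x) (W x)
          + S.psiPlus (Y x) (leviCivita (𝓡 6) Z x (X x)) (W x)
          + S.psiPlus (Y x) (Z x) (leviCivita (𝓡 6) W x (X x))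
          + (inner ℝ (X x) (Y x) * S.omega (Z x) (W x) + inner ℝ (X x) (Z x) * S.omega (W x) (Y x)
            + inner ℝ (X x) (W x) * S.omega (Y x) (Z x))) := by
  have hYZ := contMDiffAt_leviCivita hY hZ
  have hYW := contMDiffAt_leviCivita hY hW
  have h : (fun p ↦ mvfderiv (𝓡 6) (fun q ↦ S.omega (Z q) (W q)) p (Y p)) =ᶠ[𝓝 x]
      fun p ↦ S.omega (leviCivita (𝓡 6) Z p (Y p)) (W p)
        + S.omega (Z p) (leviCivita (𝓡 6) W p (Y p)) - S.psiPlus (Y p) (Z p) (W p) := by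
    filter_upwards [eventually_mdifferentiableAt hZ, eventually_mdifferentiableAt hW]
      with p h2 h3
    exact hS.mvfderiv_omega h2 h3 _
  have d {f : M → ℝ} (hf : ContMDiffAt (𝓡 6) 𝓘(ℝ, ℝ) ∞ f x) :
      MDifferentiableAt (𝓡 6) 𝓘(ℝ, ℝ) f x := hf.mdifferentiableAt (by simp)
  have add {f g : M → ℝ} (hf : ContMDiffAt (𝓡 6) 𝓘(ℝ, ℝ) ∞ f x)
      (hg : ContMDiffAt (𝓡 6) 𝓘(ℝ, ℝ) ∞ g x) :
      ContMDiffAt (𝓡 6) 𝓘(ℝ, ℝ) ∞ (fun p ↦ f p + g p) x := hf.add hg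
  have D {V : Π x : M, TangentSpace (𝓡 6) x} (hV : SmoothFieldAt V x) : DiffFieldAt V x :=
    mdifferentiableAt_of_contMDiffAt hV
  have o1 := contMDiffAt_omega (S := S) hYZ hW
  have o2 := contMDiffAt_omega (S := S) hZ hYW
  rw [mvfderiv_congr_of_eventuallyEq h,
    mvfderiv_fun_sub (d (add o1 o2)) (d (contMDiffAt_psiPlus hY hZ hW)),
    mvfderiv_fun_add (d o1) (d o2), sub_apply, add_apply,
    hS.mvfderiv_omega (D hYZ) (D hW), hS.mvfderiv_omega (D hZ) (D hYW),
    hS.mvfderiv_psiPlus (D hY) (D hZ) (D hW)]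

/-- The curvature acts on `ω` as the curvature of the unit sphere would. -/
theorem omega_curvatureField (hX : SmoothFieldAt X x) (hY : SmoothFieldAt Y x)
    (hZ : SmoothFieldAt Z x) (hW : SmoothFieldAt W x) :
    S.omega (curvatureField (𝓡 6) X Y Z x) (W x) + S.omega (Z x) (curvatureField (𝓡 6) X Y W x)
      = inner ℝ (X x) (Z x) * S.omega (W x) (Y x) + inner ℝ (X x) (W x) * S.omega (Y x) (Z x)
        - (inner ℝ (Y x) (Z x) * S.omega (W x) (X x)
          + inner ℝ (Y x) (W x) * S.omega (X x) (Z x)) := by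
  have D {V : Π x : M, TangentSpace (𝓡 6) x} (hV : SmoothFieldAt V x) : DiffFieldAt V x :=
    mdifferentiableAt_of_contMDiffAt hV
  have h := mvfderiv_mlieBracket (contMDiffAt_omega (S := S) hZ hW) hX hY
  rw [hS.mvfderiv_mvfderiv_omega hY hZ hW, hS.mvfderiv_mvfderiv_omega hX hZ hW,
    hS.mvfderiv_omega (D hZ) (D hW)] at h
  have ht : S.psiPlus (mlieBracket (𝓡 6) X Y x) (Z x) (W x)
      = S.psiPlus (leviCivita (𝓡 6) Y x (X x)) (Z x) (W x)
        - S.psiPlus (leviCivita (𝓡 6) X x (Y x)) (Z x) (W x) := by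
    rw [← leviCivita_torsion (𝓡 6) (D hX) (D hY), SU3Structure.psiPlus_sub_left]
  rw [ht, real_inner_comm (X x) (Y x)] at h
  simp only [curvatureField, SU3Structure.omega_sub_left, SU3Structure.omega_sub_right]
  linarith

theorem mvfderiv_mvfderiv_psiPlus (hY : SmoothFieldAt Y x)
    (hZ : SmoothFieldAt Z x) (hW : SmoothFieldAt W x) (hU : SmoothFieldAt U x) :
    mvfderiv (𝓡 6) (fun p ↦ mvfderiv (𝓡 6) (fun q ↦ S.psiPlus (Z q) (W q) (U q)) p (Y p)) x (X x)
      = mvfderiv (𝓡 6)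
          (fun p ↦ S.psiPlus (leviCivita (𝓡 6) Z p (Y p)) (W p) (U p)) x (X x)
        + mvfderiv (𝓡 6)
          (fun p ↦ S.psiPlus (Z p) (leviCivita (𝓡 6) W p (Y p)) (U p)) x (X x)
        + mvfderiv (𝓡 6)
          (fun p ↦ S.psiPlus (Z p) (W p) (leviCivita (𝓡 6) U p (Y p))) x (X x)
        + (mvfderiv (𝓡 6) (fun p ↦ inner ℝ (Y p) (Z p) * S.omega (W p) (U p)) x (X x)
          + mvfderiv (𝓡 6) (fun p ↦ inner ℝ (Y p) (W p) * S.omega (U p) (Z p)) x (X x)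
          + mvfderiv (𝓡 6) (fun p ↦ inner ℝ (Y p) (U p) * S.omega (Z p) (W p)) x (X x)) := by
  have h : (fun p ↦ mvfderiv (𝓡 6) (fun q ↦ S.psiPlus (Z q) (W q) (U q)) p (Y p)) =ᶠ[𝓝 x]
      fun p ↦ S.psiPlus (leviCivita (𝓡 6) Z p (Y p)) (W p) (U p)
        + S.psiPlus (Z p) (leviCivita (𝓡 6) W p (Y p)) (U p)
        + S.psiPlus (Z p) (W p) (leviCivita (𝓡 6) U p (Y p))
        + (inner ℝ (Y p) (Z p) * S.omega (W p) (U p) + inner ℝ (Y p) (W p) * S.omega (U p) (Z p)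
          + inner ℝ (Y p) (U p) * S.omega (Z p) (W p)) := by
    filter_upwards [eventually_mdifferentiableAt hZ, eventually_mdifferentiableAt hW,
      eventually_mdifferentiableAt hU] with p h2 h3 h4
    exact hS.mvfderiv_psiPlus h2 h3 h4 _
  have d {f : M → ℝ} (hf : ContMDiffAt (𝓡 6) 𝓘(ℝ, ℝ) ∞ f x) :
      MDifferentiableAt (𝓡 6) 𝓘(ℝ, ℝ) f x := hf.mdifferentiableAt (by simp)
  have add {f g : M → ℝ} (hf : ContMDiffAt (𝓡 6) 𝓘(ℝ, ℝ) ∞ f x)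
      (hg : ContMDiffAt (𝓡 6) 𝓘(ℝ, ℝ) ∞ g x) :
      ContMDiffAt (𝓡 6) 𝓘(ℝ, ℝ) ∞ (fun p ↦ f p + g p) x := hf.add hg
  have mul {f g : M → ℝ} (hf : ContMDiffAt (𝓡 6) 𝓘(ℝ, ℝ) ∞ f x)
      (hg : ContMDiffAt (𝓡 6) 𝓘(ℝ, ℝ) ∞ g x) :
      ContMDiffAt (𝓡 6) 𝓘(ℝ, ℝ) ∞ (fun p ↦ f p * g p) x := hf.mul hg
  have p1 := contMDiffAt_psiPlus (S := S) (contMDiffAt_leviCivita hY hZ) hW hU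
  have p2 := contMDiffAt_psiPlus (S := S) hZ (contMDiffAt_leviCivita hY hW) hU
  have p3 := contMDiffAt_psiPlus (S := S) hZ hW (contMDiffAt_leviCivita hY hU)
  have q1 := mul (contMDiffAt_inner hY hZ) (contMDiffAt_omega (S := S) hW hU)
  have q2 := mul (contMDiffAt_inner hY hW) (contMDiffAt_omega (S := S) hU hZ)
  have q3 := mul (contMDiffAt_inner hY hU) (contMDiffAt_omega (S := S) hZ hW)
  rw [mvfderiv_congr_of_eventuallyEq h,
    mvfderiv_fun_add (d (add (add p1 p2) p3)) (d (add (add q1 q2) q3)),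
    mvfderiv_fun_add (d (add p1 p2)) (d p3), mvfderiv_fun_add (d p1) (d p2),
    mvfderiv_fun_add (d (add q1 q2)) (d q3), mvfderiv_fun_add (d q1) (d q2)]
  simp only [add_apply]

theorem mvfderiv_inner_mul_omega (hY : DiffFieldAt Y x) (hZ : DiffFieldAt Z x)
    (hW : DiffFieldAt W x) (hU : DiffFieldAt U x)
    (ho : MDifferentiableAt (𝓡 6) 𝓘(ℝ, ℝ) (fun p ↦ S.omega (W p) (U p)) x)
    (u : TangentSpace (𝓡 6) x) :
    mvfderiv (𝓡 6) (fun p ↦ inner ℝ (Y p) (Z p) * S.omega (W p) (U p)) x u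
      = inner ℝ (Y x) (Z x) * (S.omega (leviCivita (𝓡 6) W x u) (U x)
          + S.omega (W x) (leviCivita (𝓡 6) U x u) - S.psiPlus u (W x) (U x))
        + (inner ℝ (leviCivita (𝓡 6) Y x u) (Z x) + inner ℝ (Y x) (leviCivita (𝓡 6) Z x u))
          * S.omega (W x) (U x) := by
  rw [mvfderiv_fun_mul (mdifferentiableAt_inner hY hZ) ho]
  simp only [add_apply, smul_apply, smul_eq_mul]
  rw [hS.mvfderiv_omega hW hU, mvfderiv_inner_apply hY hZ]
  ring

/-- The curvature acts on `ψ⁺` as the curvature of the unit sphere would. -/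
theorem psiPlus_curvatureField (hX : SmoothFieldAt X x) (hY : SmoothFieldAt Y x)
    (hZ : SmoothFieldAt Z x) (hW : SmoothFieldAt W x) (hU : SmoothFieldAt U x) :
    S.psiPlus (curvatureField (𝓡 6) X Y Z x) (W x) (U x)
        + S.psiPlus (curvatureField (𝓡 6) X Y W x) (U x) (Z x)
        + S.psiPlus (curvatureField (𝓡 6) X Y U x) (Z x) (W x)
      = inner ℝ (Y x) (Z x) * S.psiPlus (X x) (W x) (U x)
        + inner ℝ (Y x) (W x) * S.psiPlus (X x) (U x) (Z x)
        + inner ℝ (Y x) (U x) * S.psiPlus (X x) (Z x) (W x)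
        - (inner ℝ (X x) (Z x) * S.psiPlus (Y x) (W x) (U x)
          + inner ℝ (X x) (W x) * S.psiPlus (Y x) (U x) (Z x)
          + inner ℝ (X x) (U x) * S.psiPlus (Y x) (Z x) (W x)) := by
  have D {V : Π x : M, TangentSpace (𝓡 6) x} (hV : SmoothFieldAt V x) : DiffFieldAt V x :=
    mdifferentiableAt_of_contMDiffAt hV
  have h := mvfderiv_mlieBracket (contMDiffAt_psiPlus (S := S) hZ hW hU) hX hY
  have o {A B : Π x : M, TangentSpace (𝓡 6) x} (hA : SmoothFieldAt A x) (hB : SmoothFieldAt B x) :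
      MDifferentiableAt (𝓡 6) 𝓘(ℝ, ℝ) (fun p ↦ S.omega (A p) (B p)) x :=
    (contMDiffAt_omega hA hB).mdifferentiableAt (by simp)
  rw [hS.mvfderiv_mvfderiv_psiPlus hY hZ hW hU, hS.mvfderiv_mvfderiv_psiPlus hX hZ hW hU,
    hS.mvfderiv_psiPlus (D hZ) (D hW) (D hU),
    hS.mvfderiv_psiPlus (D (contMDiffAt_leviCivita hY hZ)) (D hW) (D hU),
    hS.mvfderiv_psiPlus (D hZ) (D (contMDiffAt_leviCivita hY hW)) (D hU),
    hS.mvfderiv_psiPlus (D hZ) (D hW) (D (contMDiffAt_leviCivita hY hU)),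
    hS.mvfderiv_psiPlus (D (contMDiffAt_leviCivita hX hZ)) (D hW) (D hU),
    hS.mvfderiv_psiPlus (D hZ) (D (contMDiffAt_leviCivita hX hW)) (D hU),
    hS.mvfderiv_psiPlus (D hZ) (D hW) (D (contMDiffAt_leviCivita hX hU)),
    hS.mvfderiv_inner_mul_omega (D hY) (D hZ) (D hW) (D hU) (o hW hU),
    hS.mvfderiv_inner_mul_omega (D hY) (D hW) (D hU) (D hZ) (o hU hZ),
    hS.mvfderiv_inner_mul_omega (D hY) (D hU) (D hZ) (D hW) (o hZ hW),
    hS.mvfderiv_inner_mul_omega (D hX) (D hZ) (D hW) (D hU) (o hW hU),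
    hS.mvfderiv_inner_mul_omega (D hX) (D hW) (D hU) (D hZ) (o hU hZ),
    hS.mvfderiv_inner_mul_omega (D hX) (D hU) (D hZ) (D hW) (o hZ hW)] at h
  have ht (v : TangentSpace (𝓡 6) x) : inner ℝ (mlieBracket (𝓡 6) X Y x) v
      = inner ℝ (leviCivita (𝓡 6) Y x (X x)) v - inner ℝ (leviCivita (𝓡 6) X x (Y x)) v := by
    rw [← leviCivita_torsion (𝓡 6) (D hX) (D hY), inner_sub_left]
  have r1 (v : TangentSpace (𝓡 6) x) :
      S.psiPlus (Z x) v (U x) = S.psiPlus v (U x) (Z x) := SU3Structure.psiPlus_rotate _ _ _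
  have r2 (v : TangentSpace (𝓡 6) x) :
      S.psiPlus (Z x) (W x) v = S.psiPlus v (Z x) (W x) :=
    (SU3Structure.psiPlus_rotate _ _ _).symm
  simp only [ht, r1, r2] at h
  simp only [curvatureField, SU3Structure.psiPlus_sub_left]
  linarith

end SU3Structure.IsNearlyKahler

end NearlyKahlerManifold

/-! ### The curvature operator of a nearly Kähler manifold -/

section Curvature

variable {E : Type*} [NormedAddCommGroup E] [NormedSpace ℝ E] [FiniteDimensional ℝ E]
  {H : Type*} [TopologicalSpace H] {I : ModelWithCorners ℝ E H} [I.Boundaryless]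
  {M : Type*} [TopologicalSpace M] [ChartedSpace H M]
  [RiemannianBundle (fun x : M ↦ TangentSpace I x)] [IsManifold I ∞ M]
  [IsContMDiffRiemannianBundle I ∞ E (fun x : M ↦ TangentSpace I x)]

theorem isAlgCurvature_riemann (x : M) : IsAlgCurvature (riemann I (x := x)) where
  swap_left := riemann_swap_left
  swap_right := riemann_swap_right
  bianchi := riemann_bianchi
  add_right _ _ _ _ _ := inner_add_right _ _ _
  smul_right _ _ _ _ _ := real_inner_smul_right _ _ _

theorem SectionalCurvatureBetween.riemann_mem_Icc {δ Δ : ℝ}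
    (h : SectionalCurvatureBetween I M δ Δ) {x : M} {u v : TangentSpace I x}
    (hu : inner ℝ u u = (1 : ℝ)) (hv : inner ℝ v v = (1 : ℝ)) (huv : inner ℝ u v = (0 : ℝ)) :
    riemann I u v v u ∈ Set.Icc δ Δ := by
  have hli : LinearIndependent ℝ ![u, v] := by
    refine LinearIndependent.pair_iff.2 fun s t hst ↦ ⟨?_, ?_⟩
    · have := congrArg (fun w ↦ inner ℝ w u) hst
      simpa [inner_add_left, real_inner_smul_left, hu, real_inner_comm u v, huv,
        -inner_self_eq_norm_sq_to_K] using this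
    · have := congrArg (fun w ↦ inner ℝ w v) hst
      simpa [inner_add_left, real_inner_smul_left, hv, huv,
        -inner_self_eq_norm_sq_to_K] using this
  have := h x u v hli
  rw [sectionalCurvature, hu, hv, huv] at this
  norm_num at this
  exact this

end Curvature

section NearlyKahlerManifold

variable {M : Type*} [TopologicalSpace M] [ChartedSpace (EuclideanSpace ℝ (Fin 6)) M]
  [RiemannianBundle (fun x : M ↦ TangentSpace (𝓡 6) x)] [IsManifold (𝓡 6) ∞ M]
  [IsContMDiffRiemannianBundle (𝓡 6) ∞ (EuclideanSpace ℝ (Fin 6))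
      (fun x : M ↦ TangentSpace (𝓡 6) x)]
  {S : SU3Structure M}

theorem finrank_tangentSpace (x : M) : Module.finrank ℝ (TangentSpace (𝓡 6) x) = 6 :=
  finrank_euclideanSpace_fin

/-- The difference between the curvature of `M` and that of the unit sphere is of Kähler type. -/
theorem SU3Structure.IsNearlyKahler.isKahlerType (hS : S.IsNearlyKahler) (x : M) :
    IsKahlerType (S.J x) (riemann (𝓡 6) (x := x) - unitCurvature) where
  toIsAlgCurvature := (isAlgCurvature_riemann x).sub_unitCurvature
  J_right u v w z := by
    have h := hS.omega_curvatureField (contMDiffAt_extend u) (contMDiffAt_extend v)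
      (contMDiffAt_extend w) (contMDiffAt_extend z)
    simp only [FiberBundle.extend_apply_self, SU3Structure.omega] at h
    have hJ := inner_J_left (S.J_J x) (S.inner_J_J x)
    rw [hJ, real_inner_comm _ (S.J x w), real_inner_comm v (S.J x z),
      real_inner_comm u (S.J x z), hJ v, hJ u] at h
    have h1 : riemann (𝓡 6) u v (S.J x w) z = -riemann (𝓡 6) u v z (S.J x w) :=
      riemann_swap_right _ _ _ _
    simp only [Pi.sub_apply, unitCurvature]
    rw [h1]
    simp only [riemann]
    linarith

/-- The difference between the curvature of `M` and that of the unit sphere takes values in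
`su(3)`: besides commuting with `J`, its curvature operators have vanishing complex trace. -/
theorem SU3Structure.IsNearlyKahler.sum_sub_unitCurvature_eq_zero (hS : S.IsNearlyKahler) {x : M}
    {e : Fin 3 → TangentSpace (𝓡 6) x} (he : IsUnitaryFrame (S.J x) e)
    (u v : TangentSpace (𝓡 6) x) :
    ∑ a, (riemann (𝓡 6) (x := x) - unitCurvature :
      TangentSpace (𝓡 6) x → TangentSpace (𝓡 6) x → TangentSpace (𝓡 6) x → TangentSpace (𝓡 6) x
        → ℝ) u v (e a) (S.J x (e a)) = 0 := by
  let A : TangentSpace (𝓡 6) x → TangentSpace (𝓡 6) x := fun w ↦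
    curvatureField (𝓡 6) (FiberBundle.extend (EuclideanSpace ℝ (Fin 6)) u)
      (FiberBundle.extend (EuclideanSpace ℝ (Fin 6)) v)
      (FiberBundle.extend (EuclideanSpace ℝ (Fin 6)) w) x
        - (inner ℝ v w • u - inner ℝ u w • v)
  have hK := hS.isKahlerType x
  set K := riemann (𝓡 6) (x := x) - unitCurvature with hKdef
  have hAK (w z : TangentSpace (𝓡 6) x) : inner ℝ (A w) z = K u v w z := by
    simp only [A, inner_sub_left, real_inner_smul_left, hKdef, Pi.sub_apply, unitCurvature, riemann]
  simp only [← hAK]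
  refine sum_inner_J_eq_zero (S.isThreeZeroForm x) he (S.inner_J_J x) (finrank_tangentSpace x)
    ((S.isThreeZeroForm x).apply_frame_ne_zero (S.J_J x) (S.inner_J_J x) he (S.normalised x)) A
    (fun w ↦ ?_) (fun w ↦ ?_) (fun a b c ↦ ?_)
  · rw [hAK]
    linarith [hK.swap_right u v w w]
  · refine ext_inner_right ℝ fun z ↦ ?_
    rw [hAK, hK.J_right, inner_J_left (S.J_J x) (S.inner_J_J x), hAK]
  · have h := hS.psiPlus_curvatureField (contMDiffAt_extend u) (contMDiffAt_extend v)
      (contMDiffAt_extend a) (contMDiffAt_extend b) (contMDiffAt_extend c)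
    simp only [FiberBundle.extend_apply_self] at h
    have h1 : S.psiPlus (A a) b c + S.psiPlus (A b) c a + S.psiPlus (A c) a b = 0 := by
      simp only [A, SU3Structure.psiPlus_sub_left, SU3Structure.psiPlus_smul_left]
      linarith
    rw [Complex.add_re, Complex.add_re]
    rw [← SU3Structure.psiPlus_rotate a, SU3Structure.psiPlus_rotate (A c)] at h1
    exact h1

/-- `R̊h` in terms of a unitary frame `f` of eigenvectors of `h` instead of the basis `e`. -/
theorem ringCurvature_apply {x : M} (e : OrthonormalBasis (Fin 6) ℝ (TangentSpace (𝓡 6) x))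
    {h : LinearMap.BilinForm ℝ (TangentSpace (𝓡 6) x)} {f : Fin 3 → TangentSpace (𝓡 6) x}
    {c : Fin 3 → ℝ} (hf : IsUnitaryFrame (S.J x) f)
    (h1 : ∀ a v, h (f a) v = c a * inner ℝ (f a) v)
    (h2 : ∀ a v, h (S.J x (f a)) v = c a * inner ℝ (S.J x (f a)) v)
    (u v : TangentSpace (𝓡 6) x) :
    ringCurvature (𝓡 6) e h u v = ringForm (S.J x) (riemann (𝓡 6) (x := x)) f c u v := by
  have hR := isAlgCurvature_riemann (I := 𝓡 6) x
  have key : ringCurvature (𝓡 6) e h = hR.ringBilin (S.J x) f c := by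
    refine LinearMap.BilinForm.ext_basis e.toBasis fun i j ↦ ?_
    have hsum := sum_mul_eq_sum_diagonal e (hf.basis (S.inner_J_J x) (finrank_tangentSpace x))
      (hR.contractionForm (e i) (e j)) h (Sum.elim c c) (by rintro (a | a) w <;> simp [h1, h2])
    simp only [Fintype.sum_sum_type, IsUnitaryFrame.basis_inl, IsUnitaryFrame.basis_inr,
      Sum.elim_inl, Sum.elim_inr, IsAlgCurvature.contractionForm, LinearMap.mk₂_apply] at hsum
    rw [ringCurvature]
    simp only [LinearMap.coe_mk, AddHom.coe_mk]
    rw [← LinearMap.BilinForm.toMatrix_apply, LinearMap.BilinForm.toMatrix_toBilin, Matrix.of_apply,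
      hsum, ← Finset.sum_add_distrib]
    simp [IsAlgCurvature.ringBilin, ringForm, mul_add]
  rw [key]
  rfl

end NearlyKahlerManifold

end NearlyKahler

open NearlyKahler in
theorem mainTheorem11 {M : Type*} [TopologicalSpace M]
    [ChartedSpace (EuclideanSpace ℝ (Fin 6)) M] [IsManifold (𝓡 6) ∞ M]
    [RiemannianBundle (fun x : M ↦ TangentSpace (𝓡 6) x)]
    [IsContMDiffRiemannianBundle (𝓡 6) ∞ (EuclideanSpace ℝ (Fin 6))
      (fun x : M ↦ TangentSpace (𝓡 6) x)]
    (S : NearlyKahler.SU3Structure M) (hS : S.IsNearlyKahler) (δ Δ : ℝ)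
    (hsec : NearlyKahler.SectionalCurvatureBetween (𝓡 6) M δ Δ)
    (x : M) (e : OrthonormalBasis (Fin 6) ℝ (TangentSpace (𝓡 6) x)) :
    (∀ h ∈ S.symPlusTraceless e,
      NearlyKahler.ringCurvature (𝓡 6) e h ∈ S.symPlusTraceless e) ∧
    (∀ (r : ℝ) (h : LinearMap.BilinForm ℝ (TangentSpace (𝓡 6) x)),
      h ∈ S.symPlusTraceless e → h ≠ 0 → NearlyKahler.ringCurvature (𝓡 6) e h = r • h →
        r ∈ Set.Icc (2 * δ - Δ) (2 * Δ - δ)) := by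
  have hV := finrank_tangentSpace x
  have hJJ := S.J_J x
  have hJ := S.inner_J_J x
  have hR := isAlgCurvature_riemann (I := 𝓡 6) x
  have htrace {f : Fin 3 → TangentSpace (𝓡 6) x} (hf : IsUnitaryFrame (S.J x) f)
      (B : LinearMap.BilinForm ℝ (TangentSpace (𝓡 6) x)) :
      ∑ i, B (e i) (e i) = ∑ a, (B (f a) (f a) + B (S.J x (f a)) (S.J x (f a))) := by
    have h := sum_mul_eq_sum_diagonal e (hf.basis hJ hV) B (innerₗ _) 1 (by simp)
    simpa [Finset.sum_add_distrib, e.inner_eq_ite] using h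
  -- a unitary frame of eigenvectors of `h`, with eigenvalues of vanishing sum
  have frame (h) (hh : h ∈ S.symPlusTraceless e) :
      ∃ (f : Fin 3 → TangentSpace (𝓡 6) x) (c : Fin 3 → ℝ), IsUnitaryFrame (S.J x) f ∧
        (∀ a v, h (f a) v = c a * inner ℝ (f a) v) ∧
        (∀ a v, h (S.J x (f a)) v = c a * inner ℝ (S.J x (f a)) v) ∧ ∑ a, c a = 0 := by
    obtain ⟨hsymm, hcomm, htr⟩ := hh
    obtain ⟨f, c, hf, h1, h2⟩ := exists_unitary_eigenframe_bilinForm hV hJJ hJ hsymm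
      ((comm_omega_iff e hJJ hJ h).1 hcomm)
    refine ⟨f, c, hf, h1, h2, ?_⟩
    rw [htrace hf] at htr
    simp only [h1, h2, hJ, hf.inner_eq, if_true, mul_one, Finset.sum_add_distrib] at htr
    linarith
  refine ⟨fun h hh ↦ ?_, fun r h hh h0 hr ↦ ?_⟩
  · obtain ⟨f, c, hf, h1, h2, hc⟩ := frame h hh
    have hring := ringCurvature_apply e hf h1 h2
    refine ⟨fun u v ↦ ?_, (comm_omega_iff e hJJ hJ _).2 fun u v ↦ ?_, ?_⟩
    · rw [hring, hring, ringForm_symm hR]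
    · rw [hring, hring, ringForm_comm_J hJJ hJ (hS.isKahlerType x) hf hc]
    · rw [htrace hf]
      simp only [hring]
      exact ringForm_trace hJJ hJ (hS.isKahlerType x) hf (hS.sum_sub_unitCurvature_eq_zero hf) hc
  · obtain ⟨f, c, hf, h1, h2, hc⟩ := frame h hh
    have hc0 : c ≠ 0 := by
      rintro rfl
      refine h0 (LinearMap.BilinForm.ext_basis (hf.basis hJ hV).toBasis fun i j ↦ ?_)
      rcases i with a | a <;> simp [h1, h2]
    refine ringForm_eigenvalue_mem_Icc hR hJ hf hc hc0 (fun u v ↦ hsec.riemann_mem_Icc) fun a ↦ ?_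
    rw [← ringCurvature_apply e hf h1 h2, hr, LinearMap.smul_apply, LinearMap.smul_apply, h1,
      hf.inner_eq, if_pos rfl, mul_one, smul_eq_mul]
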